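/- **Setting (differential-form differential dynamic logic).** Let $\mathcal V$ be a set of variables and $\mathcal V'=\{x' : x\in\mathcal V\}$ the differential symbols. Terms: $\theta ::= x \mid x' \mid f(\theta_1,\dots,\theta_k) \mid \theta+\eta \mid \theta\cdot\eta \mid (\theta)'$, with number literals. Formulas: $\phi ::= \theta\ge\eta \mid p(\theta_1,\dots,\theta_k) \mid C(\phi) \mid \neg\phi \mid \phi\wedge\psi \mid \forall x\,\phi \mid \exists x\,\phi \mid [\alpha]\phi \mid \langle\alpha\rangle\phi$, where $C$ is a predicational symbol. Hybrid programs: $\alpha ::= a \mid x:=\theta \mid x':=\theta \mid {?\psi} \mid x_1'=\theta_1,\dots,x_n'=\theta_n\,\&\,\psi \mid \alpha\cup\beta \mid \alpha;\beta \mid \alpha^*$, where $a$ is a program constant and the $x_i$ are distinct. A state is a map $\nu:\mathcal V\cup\mathcal V'\to\mathbb R$. An interpretation $I$ assigns a smooth function $\mathbb R^k\to\mathbb R$ to each function symbol of arity $k$, a subset of $\mathbb R^k$ to each predicate symbol of arity $k$, a map from sets of states to sets of states to each predicational symbol, and a binary relation on states to each program constant; literals denote themselves. The value of $(\theta)'$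 in $\nu$ is $\sum_{x\in\mathcal V}\nu(x')\,\frac{\partial [\![\theta]\!]}{\partial x}(\nu)$. There is a run of $x_1'=\theta_1,\dots\,\&\,\psi$ from $\nu$ to $\omega$ iff for some $r\ge 0$ there is a flow $\varphi:[0,r]\to$ states with $\varphi(0)=\nu$ off $\{x_1',\dots,x_n'\}$ and $\varphi(r)=\omega$ that is constant on all symbols other than the $x_i,x_i'$ and such that, at every time $\zeta\in[0,r]$, $\varphi(\zeta)(x_i')$ is the time derivative of $\varphi(\cdot)(x_i)$ at $\zeta$ (no condition if $r=0$), and $x_i'=\theta_i$ and $\psi$ hold in $\varphi(\zeta)$. All other operators have their usual meaning. A formula is valid in $I$ if it is true in all states, and valid if it is valid in all $I$. A rule is sound if its conclusion is valid whenever its premises are, and locally sound if for every $I$ its conclusion is valid in $I$ whenever its premises are valid in $I$. A uniform substitution $\sigma$ maps function symbols $f(\cdot)$ to terms, predicate symbols $p(\cdot)$ and predicational symbols $C(\_)$ to formulas, and program constants to programs, where $\cdot$ and $\_$ are reserved symbols marking the argument places. Its application $\sigma(\phi)$ replaces all these symbols simultaneously and recursively, and is defined (no clash) iff it is admissible: under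 each quantifier, modality, sequential composition, loop or differential equation that binds a set $U$ of variables, and with $U=\mathcal V\cup\mathcal V'$ under each differential $(\cdot)'$ and each $C(\cdot)$, no variable of $U$ is free in a replacement of a function or predicate symbol that occurs in the argument. $\mathrm{FV}(\sigma)$ is the set of free variables of the replacements of function and predicate symbols. **Theorem (Soundness).** Let $x,y,t,s$ be distinct variables and $\bar x$ any finite vector of variables and differential symbols. 1. The following axioms are valid: * $\langle a\rangle p(\bar x)\leftrightarrow\neg[a]\neg p(\bar x)$; * $[x:=f]p(x)\leftrightarrow p(f)$; * $[?q]p\leftrightarrow(q\to p)$; * $[a\cup b]p(\bar x)\leftrightarrow[a]p(\bar x)\wedge[b]p(\bar x)$; * $[a;b]p(\bar x)\leftrightarrow[a][b]p(\bar x)$; * $[a^*]p(\bar x)\leftrightarrow p(\bar x)\wedge[a][a^*]p(\bar x)$; * (K) $[a](p(\bar x)\to q(\bar x))\to([a]p(\bar x)\to[a]q(\bar x))$; * (I) $[a^*](p(\bar x)\to[a]p(\bar x))\to(p(\bar x)\to[a^*]p(\bar x))$; * (V) $p\to[a]p$; * (DW) $[x'=f(x)\&q(x)]q(x)$; * (DC)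 $[x'=f(x)\&q(x)]r(x)\to\big([x'=f(x)\&q(x)]p(x)\leftrightarrow[x'=f(x)\&q(x)\wedge r(x)]p(x)\big)$; * (DE) $[x'=f(x)\&q(x)]p(x,x')\leftrightarrow[x'=f(x)\&q(x)][x':=f(x)]p(x,x')$; * (DI) $\big(q(x)\to P\wedge[x'=f(x)\&q(x)](P)'\big)\to[x'=f(x)\&q(x)]P$ for atomic $P$ of the form $g(x)\sim h(x)$ with ${\sim}\in\{\ge,>,\le,<,=,\ne\}$, where $(\theta\ge\eta)'\equiv(\theta>\eta)'\equiv(\theta)'\ge(\eta)'$, $(\theta\le\eta)'\equiv(\theta<\eta)'\equiv(\theta)'\le(\eta)'$ and $(\theta=\eta)'\equiv(\theta\ne\eta)'\equiv(\theta)'=(\eta)'$; * (DG) $[x'=f(x)\&q(x)]p(x)\leftrightarrow\exists y\,[x'=f(x),y'=a(x)y+b(x)\&q(x)]p(x)$; * (DS) $[x'=f\&q(x)]p(x)\leftrightarrow\forall t{\ge}0\,\big((\forall 0{\le}s{\le}t\;q(x+f\cdot s))\to[x:=x+f\cdot t]p(x)\big)$; * $[x':=f]p(x')\leftrightarrow p(f)$;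 * $(f(\bar x)+g(\bar x))'=(f(\bar x))'+(g(\bar x))'$; * $(f(\bar x)\cdot g(\bar x))'=(f(\bar x))'\cdot g(\bar x)+f(\bar x)\cdot(g(\bar x))'$; * $[y:=g(x)][y':=1]\big((f(g(x)))'=(f(y))'\cdot(g(x))'\big)$. 2. The following rules (premises / conclusion) are locally sound, hence sound: (G) $p(\bar x)\,/\,[a]p(\bar x)$; ($\forall$) $p(x)\,/\,\forall x\,p(x)$; (MP) $p\to q,\ p\,/\,q$; (CT) $f(\bar x)=g(\bar x)\,/\,c(f(\bar x))=c(g(\bar x))$; (CQ) $f(\bar x)=g(\bar x)\,/\,p(f(\bar x))\leftrightarrow p(g(\bar x))$; (CE) $p(\bar x)\leftrightarrow q(\bar x)\,/\,C(p(\bar x))\leftrightarrow C(q(\bar x))$. 3. The uniform substitution rule (US) is sound: if $\phi$ is valid and $\sigma$ is admissible for $\phi$, then $\sigma(\phi)$ is valid. 4. If $\mathrm{FV}(\sigma)=\emptyset$ and $\sigma$ is admissible for all premises and the conclusion of a rule, then the rule obtained by applying $\sigma$ to premises and conclusion is sound if the rule is one of those in 2, and it is locally sound and sound if the rule is any locally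 sound rule $\phi_1,\dots,\phi_n\,/\,\psi$. -/

import Mathlib

namespace DL

open Set

universe u

/-! ## Language -/

/-- The vocabulary: the set of variables, the function and predicate symbols of each arity, the
predicational (higher-order predicate) symbols and the program constants. -/
structure Lang where
  Var : Type u
  Fn : ℕ → Type u
  Pred : ℕ → Type u
  Qf : Type u
  PConst : Type u

variable {L : Lang.{u}}

/-- `𝒱 ∪ 𝒱'`: a variable `x` (`base x`) or a differential symbol `x'` (`prime x`). -/
inductive VarSym (L : Lang.{u}) : Type u
  | base (x : L.Var)
  | prime (x : L.Var)

/-- Terms. `num` are the number literals; `dot i` are the reserved nullary function symbols that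
stand for the arguments in the replacements of a uniform substitution; `der θ` is the
differential `(θ)'`. -/
inductive Term (L : Lang.{u}) : Type u
  | var (v : VarSym L)
  | num (q : ℚ)
  | dot (i : ℕ)
  | fn {n : ℕ} (f : L.Fn n) (args : Fin n → Term L)
  | add (θ η : Term L)
  | mul (θ η : Term L)
  | der (θ : Term L)

mutual

/-- Formulas. `hole` is the reserved predicational symbol of arity zero that stands for the
argument in the replacement of a predicational symbol. -/
inductive Formula (L : Lang.{u}) : Type u
  | ge (θ η : Term L)
  | pred {n : ℕ} (p : L.Pred n) (args : Fin n → Term L)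
  | qf (C : L.Qf) (φ : Formula L)
  | hole
  | neg (φ : Formula L)
  | conj (φ ψ : Formula L)
  | all (x : L.Var) (φ : Formula L)
  | ex (x : L.Var) (φ : Formula L)
  | box (α : Prog L) (φ : Formula L)
  | dia (α : Prog L) (φ : Formula L)

/-- Hybrid programs. `assign v θ` is the assignment `x := θ` for `v = base x` and the differential
assignment `x' := θ` for `v = prime x`; `ode x θ ψ` is the differential equation system
`x₁' = θ₁, …, xₙ' = θₙ & ψ` in distinct variables. -/
inductive Prog (L : Lang.{u}) : Type u
  | const (a : L.PConst)
  | assign (v : VarSym L) (θ : Term L)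
  | test (ψ : Formula L)
  | ode {n : ℕ} (x : Fin n ↪ L.Var) (θ : Fin n → Term L) (ψ : Formula L)
  | choice (α β : Prog L)
  | seq (α β : Prog L)
  | loop (α : Prog L)

end

/-! ## Dynamic semantics -/

abbrev State (L : Lang.{u}) : Type u := VarSym L → ℝ

open Classical in
/-- The state that agrees with `ν` except that `v` has value `r`. -/
noncomputable def State.upd (ν : State L) (v : VarSym L) (r : ℝ) : State L :=
  Function.update ν v r

structure Interp (L : Lang.{u}) where
  fn : ∀ {n : ℕ}, L.Fn n → (Fin n → ℝ) → ℝ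
  fn_smooth : ∀ {n : ℕ} (f : L.Fn n), ContDiff ℝ ((⊤ : ℕ∞) : WithTop ℕ∞) (fn f)
  pred : ∀ {n : ℕ}, L.Pred n → Set (Fin n → ℝ)
  qf : L.Qf → Set (State L) → Set (State L)
  prog : L.PConst → State L → State L → Prop
  dot : ℕ → ℝ
  hole : Set (State L)

/-- Value of a term. In the last clause the sum over all variables has finite support, since a
partial derivative by a variable that does not occur in `θ` vanishes. -/
noncomputable def Term.eval (I : Interp L) : Term L → State L → ℝ
  | .var v, ν => ν v
  | .num q, _ => (q : ℝ)
  | .dot i, _ => I.dot i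
  | .fn f args, ν => I.fn f (fun i => (args i).eval I ν)
  | .add θ η, ν => θ.eval I ν + η.eval I ν
  | .mul θ η, ν => θ.eval I ν * η.eval I ν
  | .der θ, ν =>
      ∑ᶠ x : L.Var, ν (.prime x) * deriv (fun X : ℝ => θ.eval I (ν.upd (.base x) X)) (ν (.base x))

mutual

/-- `φ.sat I ν`: the formula `φ` is true in state `ν` under interpretation `I`. -/
def Formula.sat (I : Interp L) : Formula L → State L → Prop
  | .ge θ η, ν => θ.eval I ν ≥ η.eval I ν
  | .pred p args, ν => (fun i => (args i).eval I ν) ∈ I.pred p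
  | .qf C φ, ν => ν ∈ I.qf C {ω | φ.sat I ω}
  | .hole, ν => ν ∈ I.hole
  | .neg φ, ν => ¬ φ.sat I ν
  | .conj φ ψ, ν => φ.sat I ν ∧ ψ.sat I ν
  | .all x φ, ν => ∀ r : ℝ, φ.sat I (ν.upd (.base x) r)
  | .ex x φ, ν => ∃ r : ℝ, φ.sat I (ν.upd (.base x) r)
  | .box α φ, ν => ∀ ω, α.run I ν ω → φ.sat I ω
  | .dia α φ, ν => ∃ ω, α.run I ν ω ∧ φ.sat I ω

/-- `α.run I ν ω`: the program `α` can run from state `ν` to state `ω` under interpretation `I`.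
For differential equations, `flow` is the solution on `[0, r]`; derivatives at the end points are
one-sided, and for `r = 0` the derivative condition is void. -/
def Prog.run (I : Interp L) : Prog L → State L → State L → Prop
  | .const a, ν, ω => I.prog a ν ω
  | .assign v θ, ν, ω => ω = ν.upd v (θ.eval I ν)
  | .test ψ, ν, ω => ω = ν ∧ ψ.sat I ν
  | .ode x θ ψ, ν, ω =>
      ∃ (r : ℝ) (flow : ℝ → State L), 0 ≤ r ∧
        (∀ v, (∀ i, v ≠ .prime (x i)) → flow 0 v = ν v) ∧
        flow r = ω ∧
        ∀ ζ ∈ Icc (0 : ℝ) r,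
          (∀ i, HasDerivWithinAt (fun t => flow t (.base (x i))) (flow ζ (.prime (x i)))
              (Icc 0 r) ζ) ∧
          (∀ i, flow ζ (.prime (x i)) = (θ i).eval I (flow ζ)) ∧
          ψ.sat I (flow ζ) ∧
          (∀ v, (∀ i, v ≠ .base (x i) ∧ v ≠ .prime (x i)) → flow ζ v = ν v)
  | .choice α β, ν, ω => α.run I ν ω ∨ β.run I ν ω
  | .seq α β, ν, ω => ∃ μ, α.run I ν μ ∧ β.run I μ ω
  | .loop α, ν, ω => Relation.ReflTransGen (fun μ μ' => α.run I μ μ') ν ω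

end

/-- `I ⊨ φ`. -/
def Formula.ValidIn (I : Interp L) (φ : Formula L) : Prop := ∀ ν, φ.sat I ν

def Formula.Valid (φ : Formula L) : Prop := ∀ I : Interp L, φ.ValidIn I

/-! ## Static semantics -/

/-- Free variables of a term. -/
def Term.fv : Term L → Set (VarSym L)
  | .var v => {v}
  | .num _ => ∅
  | .dot _ => ∅
  | .fn _ args => ⋃ i, (args i).fv
  | .add θ η => θ.fv ∪ η.fv
  | .mul θ η => θ.fv ∪ η.fv
  | .der θ => θ.fv ∪ {v | ∃ x, .base x ∈ θ.fv ∧ v = .prime x}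

/-- Variables and differential symbols of the left-hand sides of a differential equation system. -/
def odeVars {n : ℕ} (x : Fin n ↪ L.Var) : Set (VarSym L) :=
  {v | ∃ i, v = .base (x i) ∨ v = .prime (x i)}

/-- Bound variables of a program. -/
def Prog.bv : Prog L → Set (VarSym L)
  | .const _ => univ
  | .assign v _ => {v}
  | .test _ => ∅
  | .ode x _ _ => odeVars x
  | .choice α β => α.bv ∪ β.bv
  | .seq α β => α.bv ∪ β.bv
  | .loop α => α.bv

/-- Must-bound variables of a program. -/
def Prog.mbv : Prog L → Set (VarSym L)
  | .const _ => ∅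
  | .assign v _ => {v}
  | .test _ => ∅
  | .ode x _ _ => odeVars x
  | .choice α β => α.mbv ∩ β.mbv
  | .seq α β => α.mbv ∪ β.mbv
  | .loop _ => ∅

mutual

/-- Free variables of a formula. -/
def Formula.fv : Formula L → Set (VarSym L)
  | .ge θ η => θ.fv ∪ η.fv
  | .pred _ args => ⋃ i, (args i).fv
  | .qf _ _ => univ
  | .hole => univ
  | .neg φ => φ.fv
  | .conj φ ψ => φ.fv ∪ ψ.fv
  | .all x φ => φ.fv \ {.base x}
  | .ex x φ => φ.fv \ {.base x}
  | .box α φ => α.fv ∪ (φ.fv \ α.mbv)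
  | .dia α φ => α.fv ∪ (φ.fv \ α.mbv)

/-- Free variables of a program. -/
def Prog.fv : Prog L → Set (VarSym L)
  | .const _ => univ
  | .assign _ θ => θ.fv
  | .test ψ => ψ.fv
  | .ode x θ ψ => {v | ∃ i, v = .base (x i)} ∪ (⋃ i, (θ i).fv) ∪ ψ.fv
  | .choice α β => α.fv ∪ β.fv
  | .seq α β => α.fv ∪ (β.fv \ α.mbv)
  | .loop α => α.fv

end

/-- The symbols that are interpreted by an interpretation. -/
inductive Symb (L : Lang.{u}) : Type u
  | fn {n : ℕ} (f : L.Fn n)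
  | pred {n : ℕ} (p : L.Pred n)
  | qf (C : L.Qf)
  | const (a : L.PConst)
  | dot (i : ℕ)
  | hole

/-- Signature of a term: the symbols that occur in it. -/
def Term.sig : Term L → Set (Symb L)
  | .var _ => ∅
  | .num _ => ∅
  | .dot i => {.dot i}
  | .fn f args => {.fn f} ∪ ⋃ i, (args i).sig
  | .add θ η => θ.sig ∪ η.sig
  | .mul θ η => θ.sig ∪ η.sig
  | .der θ => θ.sig

mutual

def Formula.sig : Formula L → Set (Symb L)
  | .ge θ η => θ.sig ∪ η.sig
  | .pred p args => {.pred p} ∪ ⋃ i, (args i).sig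
  | .qf C φ => {.qf C} ∪ φ.sig
  | .hole => {.hole}
  | .neg φ => φ.sig
  | .conj φ ψ => φ.sig ∪ ψ.sig
  | .all _ φ => φ.sig
  | .ex _ φ => φ.sig
  | .box α φ => α.sig ∪ φ.sig
  | .dia α φ => α.sig ∪ φ.sig

def Prog.sig : Prog L → Set (Symb L)
  | .const a => {.const a}
  | .assign _ θ => θ.sig
  | .test ψ => ψ.sig
  | .ode _ θ ψ => (⋃ i, (θ i).sig) ∪ ψ.sig
  | .choice α β => α.sig ∪ β.sig
  | .seq α β => α.sig ∪ β.sig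
  | .loop α => α.sig

end

/-! ## Substitution of the reserved symbols

`plug τ` replaces the reserved symbols `dot i` by terms and `hole` by a formula. `PlugAdm τ` says
that all admissibility conditions that arise hold (no clash); `plug` is meaningful only then. -/

structure ArgSubst (L : Lang.{u}) where
  dot : ℕ → Option (Term L)
  hole : Option (Formula L)

/-- `{· ↦ θ}` for a vector `θ` of arguments. -/
def ArgSubst.ofArgs {n : ℕ} (θ : Fin n → Term L) : ArgSubst L where
  dot i := if h : i < n then some (θ ⟨i, h⟩) else none
  hole := none

/-- `{_ ↦ φ}`. -/
def ArgSubst.ofFormula (φ : Formula L) : ArgSubst L where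
  dot _ := none
  hole := some φ

/-- `τ` is `U`-admissible for an expression with signature `T`: the free variables of the function
replacements for symbols in `T` are disjoint from `U`. -/
def ArgSubst.UAdm (τ : ArgSubst L) (U : Set (VarSym L)) (T : Set (Symb L)) : Prop :=
  ∀ i θ, τ.dot i = some θ → .dot i ∈ T → Disjoint θ.fv U

def Term.plug (τ : ArgSubst L) : Term L → Term L
  | .var v => .var v
  | .num q => .num q
  | .dot i => (τ.dot i).getD (.dot i)
  | .fn f args => .fn f (fun i => (args i).plug τ)
  | .add θ η => .add (θ.plug τ) (η.plug τ)
  | .mul θ η => .mul (θ.plug τ) (η.plug τ)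
  | .der θ => .der (θ.plug τ)

def Term.PlugAdm (τ : ArgSubst L) : Term L → Prop
  | .var _ => True
  | .num _ => True
  | .dot _ => True
  | .fn _ args => ∀ i, (args i).PlugAdm τ
  | .add θ η => θ.PlugAdm τ ∧ η.PlugAdm τ
  | .mul θ η => θ.PlugAdm τ ∧ η.PlugAdm τ
  | .der θ => θ.PlugAdm τ ∧ τ.UAdm univ θ.sig

mutual

def Formula.plug (τ : ArgSubst L) : Formula L → Formula L
  | .ge θ η => .ge (θ.plug τ) (η.plug τ)
  | .pred p args => .pred p (fun i => (args i).plug τ)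
  | .qf C φ => .qf C (φ.plug τ)
  | .hole => τ.hole.getD .hole
  | .neg φ => .neg (φ.plug τ)
  | .conj φ ψ => .conj (φ.plug τ) (ψ.plug τ)
  | .all x φ => .all x (φ.plug τ)
  | .ex x φ => .ex x (φ.plug τ)
  | .box α φ => .box (α.plug τ) (φ.plug τ)
  | .dia α φ => .dia (α.plug τ) (φ.plug τ)

def Prog.plug (τ : ArgSubst L) : Prog L → Prog L
  | .const a => .const a
  | .assign v θ => .assign v (θ.plug τ)
  | .test ψ => .test (ψ.plug τ)
  | .ode x θ ψ => .ode x (fun i => (θ i).plug τ) (ψ.plug τ)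
  | .choice α β => .choice (α.plug τ) (β.plug τ)
  | .seq α β => .seq (α.plug τ) (β.plug τ)
  | .loop α => .loop (α.plug τ)

end

mutual

def Formula.PlugAdm (τ : ArgSubst L) : Formula L → Prop
  | .ge θ η => θ.PlugAdm τ ∧ η.PlugAdm τ
  | .pred _ args => ∀ i, (args i).PlugAdm τ
  | .qf _ φ => φ.PlugAdm τ ∧ τ.UAdm univ φ.sig
  | .hole => True
  | .neg φ => φ.PlugAdm τ
  | .conj φ ψ => φ.PlugAdm τ ∧ ψ.PlugAdm τ
  | .all x φ => φ.PlugAdm τ ∧ τ.UAdm {.base x} φ.sig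
  | .ex x φ => φ.PlugAdm τ ∧ τ.UAdm {.base x} φ.sig
  | .box α φ => α.PlugAdm τ ∧ φ.PlugAdm τ ∧ τ.UAdm (α.plug τ).bv φ.sig
  | .dia α φ => α.PlugAdm τ ∧ φ.PlugAdm τ ∧ τ.UAdm (α.plug τ).bv φ.sig

def Prog.PlugAdm (τ : ArgSubst L) : Prog L → Prop
  | .const _ => True
  | .assign _ θ => θ.PlugAdm τ
  | .test ψ => ψ.PlugAdm τ
  | .ode x θ ψ =>
      (∀ i, (θ i).PlugAdm τ ∧ τ.UAdm (odeVars x) (θ i).sig) ∧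
        ψ.PlugAdm τ ∧ τ.UAdm (odeVars x) ψ.sig
  | .choice α β => α.PlugAdm τ ∧ β.PlugAdm τ
  | .seq α β => α.PlugAdm τ ∧ β.PlugAdm τ ∧ τ.UAdm (α.plug τ).bv β.sig
  | .loop α => α.PlugAdm τ ∧ τ.UAdm (α.plug τ).bv α.sig

end

/-! ## Uniform substitution -/

/-- A uniform substitution; `none` means that the symbol is not replaced. The arguments are
written `dot 0`, `dot 1`, … in replacements of function and predicate symbols, and `hole` in
replacements of predicational symbols. -/
structure USubst (L : Lang.{u}) where
  fn : ∀ {n : ℕ}, L.Fn n → Option (Term L)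
  pred : ∀ {n : ℕ}, L.Pred n → Option (Formula L)
  qf : L.Qf → Option (Formula L)
  const : L.PConst → Option (Prog L)

/-- Free variables that the restriction of `σ` to the symbols in `T` introduces. -/
def USubst.fvOn (σ : USubst L) (T : Set (Symb L)) : Set (VarSym L) :=
  {v | (∃ (n : ℕ) (f : L.Fn n) (θ : Term L), σ.fn f = some θ ∧ .fn f ∈ T ∧ v ∈ θ.fv) ∨
    (∃ (n : ℕ) (p : L.Pred n) (φ : Formula L), σ.pred p = some φ ∧ .pred p ∈ T ∧ v ∈ φ.fv)}

/-- `FV(σ)`. -/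
def USubst.fv (σ : USubst L) : Set (VarSym L) := σ.fvOn univ

/-- `σ` is `U`-admissible for an expression with signature `T`. -/
def USubst.UAdm (σ : USubst L) (U : Set (VarSym L)) (T : Set (Symb L)) : Prop :=
  σ.fvOn T ∩ U = ∅

/-- The result of applying `σ` to a term. It is meaningful only under `Term.Adm σ`. -/
def Term.subst (σ : USubst L) : Term L → Term L
  | .var v => .var v
  | .num q => .num q
  | .dot i => .dot i
  | .fn f args =>
      match σ.fn f with
      | some θ => θ.plug (.ofArgs fun i => (args i).subst σ)
      | none => .fn f (fun i => (args i).subst σ)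
  | .add θ η => .add (θ.subst σ) (η.subst σ)
  | .mul θ η => .mul (θ.subst σ) (η.subst σ)
  | .der θ => .der (θ.subst σ)

/-- `σ` is admissible for a term: all conditions during its application hold (no clash). -/
def Term.Adm (σ : USubst L) : Term L → Prop
  | .var _ => True
  | .num _ => True
  | .dot _ => True
  | .fn f args => (∀ i, (args i).Adm σ) ∧
      ∀ θ, σ.fn f = some θ → θ.PlugAdm (.ofArgs fun i => (args i).subst σ)
  | .add θ η => θ.Adm σ ∧ η.Adm σ
  | .mul θ η => θ.Adm σ ∧ η.Adm σ
  | .der θ => θ.Adm σ ∧ σ.UAdm univ θ.sig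

mutual

/-- The result of applying `σ` to a formula. It is meaningful only under `Formula.Adm σ`. -/
def Formula.subst (σ : USubst L) : Formula L → Formula L
  | .ge θ η => .ge (θ.subst σ) (η.subst σ)
  | .pred p args =>
      match σ.pred p with
      | some φ => φ.plug (.ofArgs fun i => (args i).subst σ)
      | none => .pred p (fun i => (args i).subst σ)
  | .qf C φ =>
      match σ.qf C with
      | some ψ => ψ.plug (.ofFormula (φ.subst σ))
      | none => .qf C (φ.subst σ)
  | .hole => .hole
  | .neg φ => .neg (φ.subst σ)
  | .conj φ ψ => .conj (φ.subst σ) (ψ.subst σ)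
  | .all x φ => .all x (φ.subst σ)
  | .ex x φ => .ex x (φ.subst σ)
  | .box α φ => .box (α.subst σ) (φ.subst σ)
  | .dia α φ => .dia (α.subst σ) (φ.subst σ)

/-- The result of applying `σ` to a program. It is meaningful only under `Prog.Adm σ`. -/
def Prog.subst (σ : USubst L) : Prog L → Prog L
  | .const a => (σ.const a).getD (.const a)
  | .assign v θ => .assign v (θ.subst σ)
  | .test ψ => .test (ψ.subst σ)
  | .ode x θ ψ => .ode x (fun i => (θ i).subst σ) (ψ.subst σ)
  | .choice α β => .choice (α.subst σ) (β.subst σ)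
  | .seq α β => .seq (α.subst σ) (β.subst σ)
  | .loop α => .loop (α.subst σ)

end

mutual

/-- `σ` is admissible for a formula: all conditions during its application hold (no clash). -/
def Formula.Adm (σ : USubst L) : Formula L → Prop
  | .ge θ η => θ.Adm σ ∧ η.Adm σ
  | .pred p args => (∀ i, (args i).Adm σ) ∧
      ∀ φ, σ.pred p = some φ → φ.PlugAdm (.ofArgs fun i => (args i).subst σ)
  | .qf C φ => φ.Adm σ ∧ σ.UAdm univ φ.sig ∧
      ∀ ψ, σ.qf C = some ψ → ψ.PlugAdm (.ofFormula (φ.subst σ))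
  | .hole => True
  | .neg φ => φ.Adm σ
  | .conj φ ψ => φ.Adm σ ∧ ψ.Adm σ
  | .all x φ => φ.Adm σ ∧ σ.UAdm {.base x} φ.sig
  | .ex x φ => φ.Adm σ ∧ σ.UAdm {.base x} φ.sig
  | .box α φ => α.Adm σ ∧ φ.Adm σ ∧ σ.UAdm (α.subst σ).bv φ.sig
  | .dia α φ => α.Adm σ ∧ φ.Adm σ ∧ σ.UAdm (α.subst σ).bv φ.sig

/-- `σ` is admissible for a program: all conditions during its application hold (no clash). -/
def Prog.Adm (σ : USubst L) : Prog L → Prop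
  | .const _ => True
  | .assign _ θ => θ.Adm σ
  | .test ψ => ψ.Adm σ
  | .ode x θ ψ =>
      (∀ i, (θ i).Adm σ ∧ σ.UAdm (odeVars x) (θ i).sig) ∧ ψ.Adm σ ∧ σ.UAdm (odeVars x) ψ.sig
  | .choice α β => α.Adm σ ∧ β.Adm σ
  | .seq α β => α.Adm σ ∧ β.Adm σ ∧ σ.UAdm (α.subst σ).bv β.sig
  | .loop α => α.Adm σ ∧ σ.UAdm (α.subst σ).bv α.sig

end

/-! ## Defined operators -/

def Formula.imp (φ ψ : Formula L) : Formula L := .neg (.conj φ (.neg ψ))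

def Formula.iff (φ ψ : Formula L) : Formula L := .conj (φ.imp ψ) (ψ.imp φ)

/-- The comparison operators of atomic formulas. -/
inductive Cmp
  | ge | gt | le | lt | eq | ne

def Cmp.rel : Cmp → Term L → Term L → Formula L
  | .ge, θ, η => .ge θ η
  | .gt, θ, η => .neg (.ge η θ)
  | .le, θ, η => .ge η θ
  | .lt, θ, η => .neg (.ge θ η)
  | .eq, θ, η => .conj (.ge θ η) (.ge η θ)
  | .ne, θ, η => .neg (.conj (.ge θ η) (.ge η θ))

/-- The differential `(θ ~ η)'` of an atomic formula. -/
def Cmp.relDer : Cmp → Term L → Term L → Formula L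
  | .ge, θ, η => Cmp.rel .ge (.der θ) (.der η)
  | .gt, θ, η => Cmp.rel .ge (.der θ) (.der η)
  | .le, θ, η => Cmp.rel .le (.der θ) (.der η)
  | .lt, θ, η => Cmp.rel .le (.der θ) (.der η)
  | .eq, θ, η => Cmp.rel .eq (.der θ) (.der η)
  | .ne, θ, η => Cmp.rel .eq (.der θ) (.der η)

/-- The term `x`. -/
def tv (x : L.Var) : Term L := .var (.base x)

/-- The term `x'`. -/
def td (x : L.Var) : Term L := .var (.prime x)

/-- `f(x̄)` for a vector `x̄` of variables. -/
def fnv {n : ℕ} (f : L.Fn n) (xs : Fin n → VarSym L) : Term L := .fn f fun i => .var (xs i)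

/-- `p(x̄)` for a vector `x̄` of variables. -/
def prv {n : ℕ} (p : L.Pred n) (xs : Fin n → VarSym L) : Formula L := .pred p fun i => .var (xs i)

/-- A nullary function symbol as a term. -/
def fn0 (f : L.Fn 0) : Term L := .fn f ![]

def fn1 (f : L.Fn 1) (θ : Term L) : Term L := .fn f ![θ]

/-- A nullary predicate symbol as a formula. -/
def pr0 (p : L.Pred 0) : Formula L := .pred p ![]

def pr1 (p : L.Pred 1) (θ : Term L) : Formula L := .pred p ![θ]

/-- `x' = θ & ψ`. -/
def ode1 (x : L.Var) (θ : Term L) (ψ : Formula L) : Prog L :=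
  .ode ⟨![x], Function.injective_of_subsingleton _⟩ ![θ] ψ

/-- `x' = θ, y' = η & ψ`. -/
def ode2 (x y : L.Var) (h : x ≠ y) (θ η : Term L) (ψ : Formula L) : Prog L :=
  .ode ⟨![x, y], by
    intro i j
    fin_cases i <;> fin_cases j <;> simp [h, h.symm]⟩ ![θ, η] ψ

/-! ## The calculus -/

/-- The axioms of differential dynamic logic, with symbols and variables as parameters; `xs` is an
arbitrary finite vector of variables and differential symbols. -/
inductive DLAx : Formula L → Prop
  /-- `⟨a⟩p(x̄) ↔ ¬[a]¬p(x̄)` -/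
  | diamond {n : ℕ} (xs : Fin n → VarSym L) (a : L.PConst) (p : L.Pred n) :
      DLAx (.iff (.dia (.const a) (prv p xs)) (.neg (.box (.const a) (.neg (prv p xs)))))
  /-- `[x := f]p(x) ↔ p(f)` -/
  | assignb (x : L.Var) (f : L.Fn 0) (p : L.Pred 1) :
      DLAx (.iff (.box (.assign (.base x) (fn0 f)) (pr1 p (tv x))) (pr1 p (fn0 f)))
  /-- `[?q]p ↔ (q → p)` -/
  | testb (q p : L.Pred 0) :
      DLAx (.iff (.box (.test (pr0 q)) (pr0 p)) (.imp (pr0 q) (pr0 p)))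
  /-- `[a ∪ b]p(x̄) ↔ [a]p(x̄) ∧ [b]p(x̄)` -/
  | choiceb {n : ℕ} (xs : Fin n → VarSym L) (a b : L.PConst) (p : L.Pred n) :
      DLAx (.iff (.box (.choice (.const a) (.const b)) (prv p xs))
        (.conj (.box (.const a) (prv p xs)) (.box (.const b) (prv p xs))))
  /-- `[a; b]p(x̄) ↔ [a][b]p(x̄)` -/
  | composeb {n : ℕ} (xs : Fin n → VarSym L) (a b : L.PConst) (p : L.Pred n) :
      DLAx (.iff (.box (.seq (.const a) (.const b)) (prv p xs))
        (.box (.const a) (.box (.const b) (prv p xs))))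
  /-- `[a*]p(x̄) ↔ p(x̄) ∧ [a][a*]p(x̄)` -/
  | iterateb {n : ℕ} (xs : Fin n → VarSym L) (a : L.PConst) (p : L.Pred n) :
      DLAx (.iff (.box (.loop (.const a)) (prv p xs))
        (.conj (prv p xs) (.box (.const a) (.box (.loop (.const a)) (prv p xs)))))
  /-- `[a](p(x̄) → q(x̄)) → ([a]p(x̄) → [a]q(x̄))` -/
  | K {n : ℕ} (xs : Fin n → VarSym L) (a : L.PConst) (p q : L.Pred n) :
      DLAx (.imp (.box (.const a) (.imp (prv p xs) (prv q xs)))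
        (.imp (.box (.const a) (prv p xs)) (.box (.const a) (prv q xs))))
  /-- `[a*](p(x̄) → [a]p(x̄)) → (p(x̄) → [a*]p(x̄))` -/
  | I {n : ℕ} (xs : Fin n → VarSym L) (a : L.PConst) (p : L.Pred n) :
      DLAx (.imp (.box (.loop (.const a)) (.imp (prv p xs) (.box (.const a) (prv p xs))))
        (.imp (prv p xs) (.box (.loop (.const a)) (prv p xs))))
  /-- `p → [a]p` -/
  | V (a : L.PConst) (p : L.Pred 0) :
      DLAx (.imp (pr0 p) (.box (.const a) (pr0 p)))
  /-- `[x' = f(x) & q(x)]q(x)` -/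
  | DW (x : L.Var) (f : L.Fn 1) (q : L.Pred 1) :
      DLAx (.box (ode1 x (fn1 f (tv x)) (pr1 q (tv x))) (pr1 q (tv x)))
  /-- `[x' = f(x) & q(x)]r(x) → ([x' = f(x) & q(x)]p(x) ↔ [x' = f(x) & q(x) ∧ r(x)]p(x))` -/
  | DC (x : L.Var) (f : L.Fn 1) (p q r : L.Pred 1) :
      DLAx (.imp (.box (ode1 x (fn1 f (tv x)) (pr1 q (tv x))) (pr1 r (tv x)))
        (.iff (.box (ode1 x (fn1 f (tv x)) (pr1 q (tv x))) (pr1 p (tv x)))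
          (.box (ode1 x (fn1 f (tv x)) (.conj (pr1 q (tv x)) (pr1 r (tv x)))) (pr1 p (tv x)))))
  /-- `[x' = f(x) & q(x)]p(x, x') ↔ [x' = f(x) & q(x)][x' := f(x)]p(x, x')` -/
  | DE (x : L.Var) (f : L.Fn 1) (q : L.Pred 1) (p : L.Pred 2) :
      DLAx (.iff (.box (ode1 x (fn1 f (tv x)) (pr1 q (tv x))) (.pred p ![tv x, td x]))
        (.box (ode1 x (fn1 f (tv x)) (pr1 q (tv x)))
          (.box (.assign (.prime x) (fn1 f (tv x))) (.pred p ![tv x, td x]))))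
  /-- `(q(x) → P ∧ [x' = f(x) & q(x)](P)') → [x' = f(x) & q(x)]P`
  for every atomic postcondition `P` of the form `g(x) ~ h(x)` -/
  | DI (x : L.Var) (f : L.Fn 1) (q : L.Pred 1) (c : Cmp) (g h : L.Fn 1) :
      DLAx (.imp
        (.imp (pr1 q (tv x))
          (.conj (c.rel (fn1 g (tv x)) (fn1 h (tv x)))
            (.box (ode1 x (fn1 f (tv x)) (pr1 q (tv x)))
              (c.relDer (fn1 g (tv x)) (fn1 h (tv x))))))
        (.box (ode1 x (fn1 f (tv x)) (pr1 q (tv x))) (c.rel (fn1 g (tv x)) (fn1 h (tv x)))))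
  /-- `[x' = f(x) & q(x)]p(x) ↔ ∃y [x' = f(x), y' = a(x)y + b(x) & q(x)]p(x)` -/
  | DG (x y : L.Var) (hxy : x ≠ y) (f a b : L.Fn 1) (p q : L.Pred 1) :
      DLAx (.iff (.box (ode1 x (fn1 f (tv x)) (pr1 q (tv x))) (pr1 p (tv x)))
        (.ex y (.box
          (ode2 x y hxy (fn1 f (tv x)) (.add (.mul (fn1 a (tv x)) (tv y)) (fn1 b (tv x)))
            (pr1 q (tv x)))
          (pr1 p (tv x)))))
  /-- `[x' = f & q(x)]p(x) ↔ ∀t≥0 ((∀0≤s≤t q(x + f·s)) → [x := x + f·t]p(x))` -/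
  | DS (x t s : L.Var) (hxt : x ≠ t) (hxs : x ≠ s) (hts : t ≠ s) (f : L.Fn 0) (p q : L.Pred 1) :
      DLAx (.iff (.box (ode1 x (fn0 f) (pr1 q (tv x))) (pr1 p (tv x)))
        (.all t (.imp (.ge (tv t) (.num 0))
          (.imp
            (.all s (.imp (.conj (.ge (tv s) (.num 0)) (.ge (tv t) (tv s)))
              (pr1 q (.add (tv x) (.mul (fn0 f) (tv s))))))
            (.box (.assign (.base x) (.add (tv x) (.mul (fn0 f) (tv t)))) (pr1 p (tv x)))))))
  /-- `[x' := f]p(x') ↔ p(f)` -/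
  | Dassignb (x : L.Var) (f : L.Fn 0) (p : L.Pred 1) :
      DLAx (.iff (.box (.assign (.prime x) (fn0 f)) (pr1 p (td x))) (pr1 p (fn0 f)))
  /-- `(f(x̄) + g(x̄))' = (f(x̄))' + (g(x̄))'` -/
  | Dplus {n : ℕ} (xs : Fin n → VarSym L) (f g : L.Fn n) :
      DLAx (Cmp.rel .eq (.der (.add (fnv f xs) (fnv g xs)))
        (.add (.der (fnv f xs)) (.der (fnv g xs))))
  /-- `(f(x̄) · g(x̄))' = (f(x̄))' · g(x̄) + f(x̄) · (g(x̄))'` -/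
  | Dtimes {n : ℕ} (xs : Fin n → VarSym L) (f g : L.Fn n) :
      DLAx (Cmp.rel .eq (.der (.mul (fnv f xs) (fnv g xs)))
        (.add (.mul (.der (fnv f xs)) (fnv g xs)) (.mul (fnv f xs) (.der (fnv g xs)))))
  /-- `[y := g(x)][y' := 1]((f(g(x)))' = (f(y))' · (g(x))')` -/
  | Dcompose (x y : L.Var) (hxy : x ≠ y) (f g : L.Fn 1) :
      DLAx (.box (.assign (.base y) (fn1 g (tv x))) (.box (.assign (.prime y) (.num 1))
        (Cmp.rel .eq (.der (fn1 f (fn1 g (tv x))))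
          (.mul (.der (fn1 f (tv y))) (.der (fn1 g (tv x)))))))

/-- An axiomatic proof rule: a list of concrete premises and a concrete conclusion. -/
structure Rule (L : Lang.{u}) where
  premises : List (Formula L)
  conclusion : Formula L

/-- The conclusion is valid if all premises are. -/
def Rule.Sound (R : Rule L) : Prop := (∀ φ ∈ R.premises, φ.Valid) → R.conclusion.Valid

/-- In every interpretation, the conclusion is valid in it if all premises are valid in it. -/
def Rule.LocallySound (R : Rule L) : Prop :=
  ∀ I : Interp L, (∀ φ ∈ R.premises, φ.ValidIn I) → R.conclusion.ValidIn I

/-- The uniform substitution instance of a rule. -/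
def Rule.subst (σ : USubst L) (R : Rule L) : Rule L :=
  ⟨R.premises.map (Formula.subst σ), R.conclusion.subst σ⟩

/-- `σ` is admissible for all premises and for the conclusion. -/
def Rule.Adm (σ : USubst L) (R : Rule L) : Prop :=
  (∀ φ ∈ R.premises, φ.Adm σ) ∧ R.conclusion.Adm σ

/-- The axiomatic proof rules of differential dynamic logic. -/
inductive DLRule : Rule L → Prop
  /-- `p(x̄) / [a]p(x̄)` -/
  | G {n : ℕ} (xs : Fin n → VarSym L) (a : L.PConst) (p : L.Pred n) :
      DLRule ⟨[prv p xs], .box (.const a) (prv p xs)⟩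
  /-- `p(x) / ∀x p(x)` -/
  | gen (x : L.Var) (p : L.Pred 1) :
      DLRule ⟨[pr1 p (tv x)], .all x (pr1 p (tv x))⟩
  /-- `p → q, p / q` -/
  | MP (p q : L.Pred 0) :
      DLRule ⟨[.imp (pr0 p) (pr0 q), pr0 p], pr0 q⟩
  /-- `f(x̄) = g(x̄) / c(f(x̄)) = c(g(x̄))` -/
  | CT {n : ℕ} (xs : Fin n → VarSym L) (f g : L.Fn n) (c : L.Fn 1) :
      DLRule ⟨[Cmp.rel .eq (fnv f xs) (fnv g xs)],
        Cmp.rel .eq (fn1 c (fnv f xs)) (fn1 c (fnv g xs))⟩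
  /-- `f(x̄) = g(x̄) / p(f(x̄)) ↔ p(g(x̄))` -/
  | CQ {n : ℕ} (xs : Fin n → VarSym L) (f g : L.Fn n) (p : L.Pred 1) :
      DLRule ⟨[Cmp.rel .eq (fnv f xs) (fnv g xs)],
        .iff (pr1 p (fnv f xs)) (pr1 p (fnv g xs))⟩
  /-- `p(x̄) ↔ q(x̄) / C(p(x̄)) ↔ C(q(x̄))` -/
  | CE {n : ℕ} (xs : Fin n → VarSym L) (p q : L.Pred n) (C : L.Qf) :
      DLRule ⟨[.iff (prv p xs) (prv q xs)],
        .iff (.qf C (prv p xs)) (.qf C (prv q xs))⟩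

end DL

namespace DL

open Set

universe u

variable {L : Lang.{u}}

/-! ## Updates of states -/

theorem State.upd_same (ν : State L) (v : VarSym L) (r : ℝ) : ν.upd v r v = r := by
  simp [State.upd]

theorem State.upd_of_ne (ν : State L) {v w : VarSym L} (r : ℝ) (h : w ≠ v) :
    ν.upd v r w = ν w := by
  simp [State.upd, h]

theorem State.upd_self (ν : State L) (v : VarSym L) : ν.upd v (ν v) = ν := by
  simp [State.upd]

theorem State.upd_base_prime (ν : State L) (x y : L.Var) (r : ℝ) :
    ν.upd (.base x) r (.prime y) = ν (.prime y) :=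
  ν.upd_of_ne r (by simp)

theorem State.upd_eqOn {ν ω : State L} {V : Set (VarSym L)} {v : VarSym L} (r : ℝ)
    (h : EqOn ν ω (V \ {v})) : EqOn (ν.upd v r) (ω.upd v r) V := by
  intro w hw
  by_cases hwv : w = v
  · subst hwv; simp [State.upd_same]
  · simpa [State.upd_of_ne _ _ hwv] using h ⟨hw, hwv⟩

/-! ## Coincidence for terms -/

theorem Term.fv_finite : ∀ θ : Term L, θ.fv.Finite
  | .var _ => finite_singleton _
  | .num _ => finite_empty
  | .dot _ => finite_empty
  | .fn _ args => finite_iUnion fun i => (args i).fv_finite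
  | .add θ η => θ.fv_finite.union η.fv_finite
  | .mul θ η => θ.fv_finite.union η.fv_finite
  | .der θ => by
      refine θ.fv_finite.union ((θ.fv_finite.image fun v => match v with
        | .base x => .prime x
        | .prime x => .prime x).subset ?_)
      rintro v ⟨x, hx, rfl⟩
      exact ⟨_, hx, rfl⟩

theorem Term.eval_congr_state (I : Interp L) : ∀ (θ : Term L) {ν ω : State L},
    EqOn ν ω θ.fv → θ.eval I ν = θ.eval I ω
  | .var _, _, _, h => h rfl
  | .num _, _, _, _ => rfl
  | .dot _, _, _, _ => rfl
  | .fn f args, ν, ω, h => by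
      simp only [Term.eval]
      congr 1
      funext i
      exact (args i).eval_congr_state I (h.mono (subset_iUnion (fun i => (args i).fv) i))
  | .add θ η, ν, ω, h => by
      simp only [Term.eval]
      rw [θ.eval_congr_state I (h.mono subset_union_left),
        η.eval_congr_state I (h.mono subset_union_right)]
  | .mul θ η, ν, ω, h => by
      simp only [Term.eval]
      rw [θ.eval_congr_state I (h.mono subset_union_left),
        η.eval_congr_state I (h.mono subset_union_right)]
  | .der θ, ν, ω, h => by
      simp only [Term.eval]
      refine finsum_congr fun x => ?_
      have hθ : EqOn ν ω θ.fv := h.mono subset_union_left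
      have hfun : (fun X : ℝ => θ.eval I (ν.upd (.base x) X)) =
          fun X => θ.eval I (ω.upd (.base x) X) := by
        funext X
        exact θ.eval_congr_state I (State.upd_eqOn X (hθ.mono sdiff_subset))
      rw [hfun]
      by_cases hx : VarSym.base x ∈ θ.fv
      · rw [hθ hx, h (Or.inr ⟨x, hx, rfl⟩)]
      · have hconst : (fun X : ℝ => θ.eval I (ω.upd (.base x) X)) = fun _ => θ.eval I ω := by
          funext X
          refine θ.eval_congr_state I fun v hv => State.upd_of_ne _ _ ?_
          rintro rfl
          exact hx hv
        simp [hconst]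

/-- Partial derivatives by variables that are not free vanish. -/
theorem Term.deriv_eval_eq_zero (I : Interp L) (θ : Term L) (ν : State L) {x : L.Var}
    (hx : VarSym.base x ∉ θ.fv) (a : ℝ) :
    deriv (fun X : ℝ => θ.eval I (ν.upd (.base x) X)) a = 0 := by
  have hconst : (fun X : ℝ => θ.eval I (ν.upd (.base x) X)) = fun _ => θ.eval I ν := by
    funext X
    refine θ.eval_congr_state I fun v hv => State.upd_of_ne _ _ ?_
    rintro rfl
    exact hx hv
  simp [hconst]

theorem Term.finite_base_fv (θ : Term L) : {x : L.Var | VarSym.base x ∈ θ.fv}.Finite :=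
  θ.fv_finite.preimage (fun _ _ _ _ h => by simpa using h)

theorem Term.support_der_subset (I : Interp L) (θ : Term L) (ν : State L) :
    (Function.support fun x : L.Var => ν (.prime x) *
      deriv (fun X : ℝ => θ.eval I (ν.upd (.base x) X)) (ν (.base x))) ⊆
      θ.finite_base_fv.toFinset := by
  intro x hx
  by_contra h
  exact hx (by
    simp only []
    rw [θ.deriv_eval_eq_zero I ν (by simpa using h), mul_zero])

theorem Term.eval_der_eq_sum (I : Interp L) (θ : Term L) (ν : State L) :
    (Term.der θ).eval I ν = ∑ x ∈ θ.finite_base_fv.toFinset, ν (.prime x) *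
      deriv (fun X : ℝ => θ.eval I (ν.upd (.base x) X)) (ν (.base x)) :=
  finsum_eq_sum_of_support_subset _ (θ.support_der_subset I ν)

/-! ## Smoothness of the values of terms -/

/-- The value of a term depends smoothly on the state and on the values of the reserved symbols. -/
theorem Term.contDiff_eval (I : Interp L) (θ : Term L) : ∀ {E : Type} [NormedAddCommGroup E]
    [NormedSpace ℝ E] (D : E → ℕ → ℝ) (N : E → State L),
    (∀ i, ContDiff ℝ ((⊤ : ℕ∞) : WithTop ℕ∞) fun e => D e i) →
    (∀ v, ContDiff ℝ ((⊤ : ℕ∞) : WithTop ℕ∞) fun e => N e v) →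
    ContDiff ℝ ((⊤ : ℕ∞) : WithTop ℕ∞) fun e => θ.eval { I with dot := D e } (N e) := by
  induction θ with
  | var v => intro E _ _ D N _ hN; exact hN v
  | num q => intro E _ _ D N _ _; exact contDiff_const
  | dot i => intro E _ _ D N hD _; exact hD i
  | fn f args ih =>
      intro E _ _ D N hD hN
      exact (I.fn_smooth f).comp (contDiff_pi.2 fun i => ih i D N hD hN)
  | add θ η ih₁ ih₂ => intro E _ _ D N hD hN; exact (ih₁ D N hD hN).add (ih₂ D N hD hN)
  | mul θ η ih₁ ih₂ => intro E _ _ D N hD hN; exact (ih₁ D N hD hN).mul (ih₂ D N hD hN)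
  | der θ ih =>
      intro E _ _ D N hD hN
      simp only [Term.eval_der_eq_sum]
      refine ContDiff.sum fun x _ => (hN _).mul ?_
      have key : ContDiff ℝ ((⊤ : ℕ∞) : WithTop ℕ∞) fun p : E × ℝ =>
          θ.eval { I with dot := D p.1 } ((N p.1).upd (.base x) p.2) := by
        refine ih (fun p : E × ℝ => D p.1) (fun p : E × ℝ => (N p.1).upd (.base x) p.2)
          (fun i => (hD i).comp contDiff_fst) fun v => ?_
        by_cases hv : v = .base x
        · subst hv
          simpa only [State.upd_same] using contDiff_snd
        · simp only [State.upd_of_ne _ _ hv]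
          exact (hN v).comp contDiff_fst
      have hderiv : ∀ e, deriv (fun X : ℝ => θ.eval { I with dot := D e }
            ((N e).upd (.base x) X)) (N e (.base x)) =
          fderiv ℝ (fun p : E × ℝ => θ.eval { I with dot := D p.1 }
            ((N p.1).upd (.base x) p.2)) (e, N e (.base x)) ((0 : E), (1 : ℝ)) := by
        intro e
        have h1 := (key.differentiable (by simp) (e, N e (.base x))).hasFDerivAt
        have h2 : HasDerivAt (fun X : ℝ => (e, X)) ((0 : E), (1 : ℝ)) (N e (.base x)) :=
          (hasDerivAt_const _ e).prodMk (hasDerivAt_id _)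
        exact (h1.comp_hasDerivAt _ h2).deriv
      simp only [hderiv]
      have h3 : ContDiff ℝ ((⊤ : ℕ∞) : WithTop ℕ∞) (fderiv ℝ (fun p : E × ℝ =>
          θ.eval { I with dot := D p.1 } ((N p.1).upd (.base x) p.2))) :=
        key.fderiv_right (by simp)
      exact (h3.comp (contDiff_id.prodMk (hN _))).clm_apply contDiff_const

theorem Term.differentiable_eval_upd (I : Interp L) (θ : Term L) (ν : State L) (x : L.Var) :
    Differentiable ℝ fun X : ℝ => θ.eval I (ν.upd (.base x) X) := by
  refine (θ.contDiff_eval I (fun _ : ℝ => I.dot) (fun X => ν.upd (.base x) X)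
    (fun _ => contDiff_const) fun v => ?_).differentiable (by simp)
  by_cases hv : v = .base x
  · subst hv
    simp only [State.upd_same]
    exact contDiff_id
  · simpa only [State.upd_of_ne _ _ hv] using contDiff_const

/-! ## Coincidence for formulas and programs: states -/

/-- Bound effect: a program changes only its bound variables. -/
theorem Prog.eqOn_compl_bv (I : Interp L) : ∀ (α : Prog L) {ν ω : State L},
    α.run I ν ω → EqOn ν ω α.bvᶜ
  | .const _, _, _, _ => fun _ hv => (hv trivial).elim
  | .assign v θ, ν, ω, h => by
      intro w hw
      rw [Prog.run] at h
      rw [h, State.upd_of_ne _ _ hw]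
  | .test _, ν, ω, h => by
      rw [Prog.run] at h
      rw [h.1]
      exact eqOn_refl _ _
  | .ode x θ ψ, ν, ω, h => by
      rw [Prog.run] at h
      obtain ⟨r, flow, hr, -, rfl, hflow⟩ := h
      intro v hv
      refine ((hflow r ⟨hr, le_rfl⟩).2.2.2 v fun i => ⟨?_, ?_⟩).symm
      · exact fun h => hv ⟨i, Or.inl h⟩
      · exact fun h => hv ⟨i, Or.inr h⟩
  | .choice α β, ν, ω, h => by
      rw [Prog.run] at h
      rcases h with h | h
      · exact (α.eqOn_compl_bv I h).mono (compl_subset_compl.2 subset_union_left)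
      · exact (β.eqOn_compl_bv I h).mono (compl_subset_compl.2 subset_union_right)
  | .seq α β, ν, ω, h => by
      rw [Prog.run] at h
      obtain ⟨μ, h1, h2⟩ := h
      exact ((α.eqOn_compl_bv I h1).mono (compl_subset_compl.2 subset_union_left)).trans
        ((β.eqOn_compl_bv I h2).mono (compl_subset_compl.2 subset_union_right))
  | .loop α, ν, ω, h => by
      rw [Prog.run] at h
      induction h with
      | refl => exact eqOn_refl _ _
      | tail _ h ih => exact ih.trans (α.eqOn_compl_bv I h)

mutual

theorem Formula.sat_congr_state (I : Interp L) : ∀ (φ : Formula L) {ν ω : State L},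
    EqOn ν ω φ.fv → φ.sat I ν → φ.sat I ω
  | .ge θ η, ν, ω, h, hs => by
      rw [Formula.sat] at hs ⊢
      rwa [← θ.eval_congr_state I (h.mono subset_union_left),
        ← η.eval_congr_state I (h.mono subset_union_right)]
  | .pred p args, ν, ω, h, hs => by
      rw [Formula.sat] at hs ⊢
      convert hs using 2 with i
      exact ((args i).eval_congr_state I
        (h.mono (subset_iUnion (fun i => (args i).fv) i))).symm
  | .qf C φ, ν, ω, h, hs => by
      have : ν = ω := funext fun v => h (show v ∈ (Formula.qf C φ).fv from trivial)
      exact this ▸ hs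
  | .hole, ν, ω, h, hs => by
      have : ν = ω := funext fun v => h (show v ∈ (Formula.hole : Formula L).fv from trivial)
      exact this ▸ hs
  | .neg φ, ν, ω, h, hs => by
      rw [Formula.sat] at hs ⊢
      exact fun h' => hs (φ.sat_congr_state I (EqOn.symm h) h')
  | .conj φ ψ, ν, ω, h, hs => by
      rw [Formula.sat] at hs ⊢
      exact ⟨φ.sat_congr_state I (h.mono subset_union_left) hs.1,
        ψ.sat_congr_state I (h.mono subset_union_right) hs.2⟩
  | .all x φ, ν, ω, h, hs => by
      rw [Formula.sat] at hs ⊢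
      exact fun r => φ.sat_congr_state I (State.upd_eqOn r h) (hs r)
  | .ex x φ, ν, ω, h, hs => by
      rw [Formula.sat] at hs ⊢
      obtain ⟨r, hr⟩ := hs
      exact ⟨r, φ.sat_congr_state I (State.upd_eqOn r h) hr⟩
  | .box α φ, ν, ω, h, hs => by
      rw [Formula.sat] at hs ⊢
      intro ω' hω'
      obtain ⟨ν', hν', he⟩ := α.run_congr_state I (show α.fv ⊆ (Formula.box α φ).fv from
        subset_union_left) (EqOn.symm h) hω'
      exact φ.sat_congr_state I (EqOn.symm (he.mono (by
        rw [Formula.fv]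
        intro v hv
        by_cases hm : v ∈ α.mbv
        · exact Or.inr hm
        · exact Or.inl (Or.inr ⟨hv, hm⟩)))) (hs ν' hν')
  | .dia α φ, ν, ω, h, hs => by
      rw [Formula.sat] at hs ⊢
      obtain ⟨ν', hν', hs⟩ := hs
      obtain ⟨ω', hω', he⟩ := α.run_congr_state I (show α.fv ⊆ (Formula.dia α φ).fv from
        subset_union_left) h hν'
      exact ⟨ω', hω', φ.sat_congr_state I (he.mono (by
        rw [Formula.fv]
        intro v hv
        by_cases hm : v ∈ α.mbv
        · exact Or.inr hm
        · exact Or.inl (Or.inr ⟨hv, hm⟩))) hs⟩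

theorem Prog.run_congr_state (I : Interp L) : ∀ (α : Prog L) {V : Set (VarSym L)}
    {ν ν' ω : State L}, α.fv ⊆ V → EqOn ν ν' V → α.run I ν ω →
    ∃ ω', α.run I ν' ω' ∧ EqOn ω ω' (V ∪ α.mbv)
  | .const a, V, ν, ν', ω, hV, h, hr => by
      have : ν = ν' := funext fun v => h (hV trivial)
      exact ⟨ω, this ▸ hr, eqOn_refl _ _⟩
  | .assign v θ, V, ν, ν', ω, hV, h, hr => by
      rw [Prog.run] at hr
      refine ⟨ν'.upd v (θ.eval I ν'), by rw [Prog.run], ?_⟩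
      rw [hr, ← θ.eval_congr_state I (h.mono hV)]
      refine State.upd_eqOn _ (h.mono ?_)
      rintro w ⟨hw | hw, hne⟩
      · exact hw
      · exact (hne hw).elim
  | .test ψ, V, ν, ν', ω, hV, h, hr => by
      rw [Prog.run] at hr
      obtain ⟨rfl, hs⟩ := hr
      refine ⟨ν', ?_, h.mono (union_subset Subset.rfl (empty_subset _))⟩
      rw [Prog.run]
      exact ⟨rfl, ψ.sat_congr_state I (h.mono hV) hs⟩
  | .ode x θ ψ, V, ν, ν', ω, hV, h, hr => by
      classical
      rw [Prog.run] at hr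
      obtain ⟨r, flow, hr, h0, rfl, hflow⟩ := hr
      have hin : ∀ {v}, v ∈ odeVars x → ∀ ζ,
          (fun v => if v ∈ odeVars x then flow ζ v else ν' v) v = flow ζ v :=
        fun hv ζ => if_pos hv
      have hb : ∀ i, VarSym.base (x i) ∈ odeVars x := fun i => ⟨i, Or.inl rfl⟩
      have hp : ∀ i, VarSym.prime (x i) ∈ odeVars x := fun i => ⟨i, Or.inr rfl⟩
      have hout : ∀ {v}, v ∉ odeVars x → ∀ i, v ≠ .base (x i) ∧ v ≠ .prime (x i) :=
        fun hv i => ⟨fun h => hv ⟨i, Or.inl h⟩, fun h => hv ⟨i, Or.inr h⟩⟩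
      have hE : ∀ ζ ∈ Icc (0 : ℝ) r, EqOn (flow ζ)
          (fun v => if v ∈ odeVars x then flow ζ v else ν' v) (V ∪ odeVars x) := by
        intro ζ hζ v hv
        by_cases hx : v ∈ odeVars x
        · exact (if_pos hx).symm
        · have hvV : v ∈ V := hv.resolve_right hx
          simp only [hx, if_false]
          rw [(hflow ζ hζ).2.2.2 v (hout hx), h hvV]
      have hθ : ∀ i, (θ i).fv ⊆ V := fun i v hv =>
        hV (Or.inl (Or.inr (mem_iUnion.2 ⟨i, hv⟩)))
      have hψ : ψ.fv ⊆ V := fun v hv => hV (Or.inr hv)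
      refine ⟨fun v => if v ∈ odeVars x then flow r v else ν' v, ?_, hE r ⟨hr, le_rfl⟩⟩
      rw [Prog.run]
      refine ⟨r, fun ζ v => if v ∈ odeVars x then flow ζ v else ν' v, hr, ?_, rfl, ?_⟩
      · intro v hv
        by_cases hx : v ∈ odeVars x
        · obtain ⟨i, hi | hi⟩ := id hx
          · subst hi
            simp only [hx, if_true]
            rw [h0 _ hv]
            exact h (hV (Or.inl (Or.inl ⟨i, rfl⟩)))
          · exact (hv i hi).elim
        · exact if_neg hx
      · intro ζ hζ
        obtain ⟨h1, h2, h3, h4⟩ := hflow ζ hζ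
        refine ⟨fun i => ?_, fun i => ?_, ?_, fun v hv => ?_⟩
        · simpa only [hb i, hp i, if_true] using h1 i
        · simp only [hp i, if_true]
          rw [h2 i]
          exact (θ i).eval_congr_state I ((hE ζ hζ).mono ((hθ i).trans subset_union_left))
        · exact ψ.sat_congr_state I ((hE ζ hζ).mono (hψ.trans subset_union_left)) h3
        · refine if_neg ?_
          rintro ⟨i, hi | hi⟩
          · exact (hv i).1 hi
          · exact (hv i).2 hi
  | .choice α β, V, ν, ν', ω, hV, h, hr => by
      rw [Prog.run] at hr
      simp only [Prog.run]
      rcases hr with hr | hr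
      · obtain ⟨ω', h1, h2⟩ := α.run_congr_state I (subset_union_left.trans hV) h hr
        exact ⟨ω', Or.inl h1, h2.mono (union_subset_union_right _ inter_subset_left)⟩
      · obtain ⟨ω', h1, h2⟩ := β.run_congr_state I (subset_union_right.trans hV) h hr
        exact ⟨ω', Or.inr h1, h2.mono (union_subset_union_right _ inter_subset_right)⟩
  | .seq α β, V, ν, ν', ω, hV, h, hr => by
      rw [Prog.run] at hr
      simp only [Prog.run]
      obtain ⟨μ, hα, hβ⟩ := hr
      obtain ⟨μ', h1, h2⟩ := α.run_congr_state I (subset_union_left.trans hV) h hα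
      obtain ⟨ω', h3, h4⟩ := β.run_congr_state I (V := V ∪ α.mbv) (by
        intro v hv
        by_cases hm : v ∈ α.mbv
        · exact Or.inr hm
        · exact Or.inl (hV (Or.inr ⟨hv, hm⟩))) h2 hβ
      exact ⟨ω', ⟨μ', h1, h3⟩, h4.mono (by rw [Prog.mbv, union_assoc])⟩
  | .loop α, V, ν, ν', ω, hV, h, hr => by
      rw [Prog.run] at hr
      simp only [Prog.run, Prog.mbv, union_empty]
      induction hr with
      | refl => exact ⟨ν', .refl, h⟩
      | tail _ hstep ih =>
          obtain ⟨μ', h1, h2⟩ := ih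
          obtain ⟨ω', h3, h4⟩ := α.run_congr_state I hV h2 hstep
          exact ⟨ω', h1.tail h3, h4.mono subset_union_left⟩

end

/-! ## Coincidence: interpretations -/

/-- The interpretations `I` and `J` agree on the symbols in `T`. -/
structure Interp.AgreeOn (I J : Interp L) (T : Set (Symb L)) : Prop where
  fn : ∀ {n : ℕ} (f : L.Fn n), .fn f ∈ T → I.fn f = J.fn f
  pred : ∀ {n : ℕ} (p : L.Pred n), .pred p ∈ T → I.pred p = J.pred p
  qf : ∀ C, .qf C ∈ T → I.qf C = J.qf C
  prog : ∀ a, .const a ∈ T → I.prog a = J.prog a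
  dot : ∀ i, .dot i ∈ T → I.dot i = J.dot i
  hole : .hole ∈ T → I.hole = J.hole

theorem Interp.AgreeOn.mono {I J : Interp L} {S T : Set (Symb L)} (h : I.AgreeOn J T)
    (hST : S ⊆ T) : I.AgreeOn J S where
  fn f hf := h.fn f (hST hf)
  pred p hp := h.pred p (hST hp)
  qf C hC := h.qf C (hST hC)
  prog a ha := h.prog a (hST ha)
  dot i hi := h.dot i (hST hi)
  hole hh := h.hole (hST hh)

theorem Term.eval_congr_interp {I J : Interp L} : ∀ (θ : Term L), I.AgreeOn J θ.sig →
    θ.eval I = θ.eval J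
  | .var _, _ => rfl
  | .num _, _ => rfl
  | .dot i, h => funext fun _ => h.dot i rfl
  | .fn f args, h => by
      funext ν
      simp only [Term.eval]
      rw [h.fn f (Or.inl rfl)]
      congr 1
      funext i
      rw [(args i).eval_congr_interp (h.mono
        ((subset_iUnion (fun i => (args i).sig) i).trans subset_union_right))]
  | .add θ η, h => by
      funext ν
      simp only [Term.eval]
      rw [θ.eval_congr_interp (h.mono subset_union_left),
        η.eval_congr_interp (h.mono subset_union_right)]
  | .mul θ η, h => by
      funext ν
      simp only [Term.eval]
      rw [θ.eval_congr_interp (h.mono subset_union_left),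
        η.eval_congr_interp (h.mono subset_union_right)]
  | .der θ, h => by
      funext ν
      simp only [Term.eval]
      rw [θ.eval_congr_interp h]

mutual

theorem Formula.sat_congr_interp {I J : Interp L} : ∀ (φ : Formula L), I.AgreeOn J φ.sig →
    φ.sat I = φ.sat J
  | .ge θ η, h => by
      funext ν
      simp only [Formula.sat]
      rw [θ.eval_congr_interp (h.mono subset_union_left),
        η.eval_congr_interp (h.mono subset_union_right)]
  | .pred p args, h => by
      funext ν
      simp only [Formula.sat]
      rw [h.pred p (Or.inl rfl)]
      congr 1
      funext i
      rw [(args i).eval_congr_interp (h.mono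
        ((subset_iUnion (fun i => (args i).sig) i).trans subset_union_right))]
  | .qf C φ, h => by
      funext ν
      simp only [Formula.sat]
      rw [h.qf C (Or.inl rfl), φ.sat_congr_interp (h.mono subset_union_right)]
  | .hole, h => by
      funext ν
      simp only [Formula.sat]
      rw [h.hole rfl]
  | .neg φ, h => by
      funext ν
      simp only [Formula.sat]
      rw [φ.sat_congr_interp h]
  | .conj φ ψ, h => by
      funext ν
      simp only [Formula.sat]
      rw [φ.sat_congr_interp (h.mono subset_union_left),
        ψ.sat_congr_interp (h.mono subset_union_right)]
  | .all x φ, h => by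
      funext ν
      simp only [Formula.sat]
      rw [φ.sat_congr_interp h]
  | .ex x φ, h => by
      funext ν
      simp only [Formula.sat]
      rw [φ.sat_congr_interp h]
  | .box α φ, h => by
      funext ν
      simp only [Formula.sat]
      rw [α.run_congr_interp (h.mono subset_union_left),
        φ.sat_congr_interp (h.mono subset_union_right)]
  | .dia α φ, h => by
      funext ν
      simp only [Formula.sat]
      rw [α.run_congr_interp (h.mono subset_union_left),
        φ.sat_congr_interp (h.mono subset_union_right)]

theorem Prog.run_congr_interp {I J : Interp L} : ∀ (α : Prog L), I.AgreeOn J α.sig →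
    α.run I = α.run J
  | .const a, h => by
      funext ν ω
      simp only [Prog.run]
      rw [h.prog a rfl]
  | .assign v θ, h => by
      funext ν ω
      simp only [Prog.run]
      rw [θ.eval_congr_interp h]
  | .test ψ, h => by
      funext ν ω
      simp only [Prog.run]
      rw [ψ.sat_congr_interp h]
  | .ode x θ ψ, h => by
      funext ν ω
      have hθ : ∀ i, (θ i).eval I = (θ i).eval J := fun i => (θ i).eval_congr_interp (h.mono
        ((subset_iUnion (fun i => (θ i).sig) i).trans subset_union_left))
      simp only [Prog.run, hθ]
      rw [ψ.sat_congr_interp (h.mono subset_union_right)]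
  | .choice α β, h => by
      funext ν ω
      simp only [Prog.run]
      rw [α.run_congr_interp (h.mono subset_union_left),
        β.run_congr_interp (h.mono subset_union_right)]
  | .seq α β, h => by
      funext ν ω
      simp only [Prog.run]
      rw [α.run_congr_interp (h.mono subset_union_left),
        β.run_congr_interp (h.mono subset_union_right)]
  | .loop α, h => by
      funext ν ω
      simp only [Prog.run]
      rw [α.run_congr_interp h]

end

/-! ## Transfer of differential equations and loops -/

theorem Prog.run_ode_congr {I J : Interp L} {n : ℕ} {x : Fin n ↪ L.Var} {θ θ' : Fin n → Term L}
    {ψ ψ' : Formula L} {ν ω : State L}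
    (hθ : ∀ i μ, EqOn ν μ (odeVars x)ᶜ → (θ i).eval I μ = (θ' i).eval J μ)
    (hψ : ∀ μ, EqOn ν μ (odeVars x)ᶜ → (ψ.sat I μ ↔ ψ'.sat J μ)) :
    (Prog.ode x θ ψ).run I ν ω ↔ (Prog.ode x θ' ψ').run J ν ω := by
  simp only [Prog.run]
  have hE : ∀ μ : State L, (∀ v, (∀ i, v ≠ .base (x i) ∧ v ≠ .prime (x i)) → μ v = ν v) →
      EqOn ν μ (odeVars x)ᶜ := fun μ h v hv =>
    (h v fun i => ⟨fun h => hv ⟨i, Or.inl h⟩, fun h => hv ⟨i, Or.inr h⟩⟩).symm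
  refine exists_congr fun r => exists_congr fun flow => and_congr_right fun _ =>
    and_congr_right fun _ => and_congr_right fun _ => forall₂_congr fun ζ _ =>
    and_congr_right fun _ => ?_
  constructor
  · rintro ⟨h2, h3, h4⟩
    exact ⟨fun i => (h2 i).trans (hθ i _ (hE _ h4)), (hψ _ (hE _ h4)).1 h3, h4⟩
  · rintro ⟨h2, h3, h4⟩
    exact ⟨fun i => (h2 i).trans (hθ i _ (hE _ h4)).symm, (hψ _ (hE _ h4)).2 h3, h4⟩

theorem reflTransGen_iff_of_invariant {α : Type*} {R S : α → α → Prop} {P : α → Prop} {a b : α}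
    (ha : P a) (hR : ∀ c d, P c → R c d → P d) (h : ∀ c d, P c → (R c d ↔ S c d)) :
    Relation.ReflTransGen R a b ↔ Relation.ReflTransGen S a b := by
  constructor
  · intro H
    have : P b ∧ Relation.ReflTransGen S a b := by
      induction H with
      | refl => exact ⟨ha, .refl⟩
      | tail _ h' ih => exact ⟨hR _ _ ih.1 h', ih.2.tail ((h _ _ ih.1).1 h')⟩
    exact this.2
  · intro H
    have : P b ∧ Relation.ReflTransGen R a b := by
      induction H with
      | refl => exact ⟨ha, .refl⟩
      | tail _ h' ih =>
          have hr := (h _ _ ih.1).2 h'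
          exact ⟨hR _ _ ih.1 hr, ih.2.tail hr⟩
    exact this.2

/-! ## Substitution of the reserved symbols -/

/-- The adjoint of an argument substitution: the interpretation in which the reserved symbols have
the values of their replacements in `ν`. -/
noncomputable def ArgSubst.adj (τ : ArgSubst L) (I : Interp L) (ν : State L) : Interp L :=
  { I with
    dot := fun i => (τ.dot i).elim (I.dot i) fun θ => θ.eval I ν
    hole := τ.hole.elim I.hole fun φ => {ω | φ.sat I ω} }

theorem ArgSubst.adj_agreeOn {τ : ArgSubst L} {U : Set (VarSym L)} {T : Set (Symb L)}
    (h : τ.UAdm U T) (I : Interp L) {ν ω : State L} (hE : EqOn ν ω Uᶜ) :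
    (τ.adj I ω).AgreeOn (τ.adj I ν) T where
  fn _ _ := rfl
  pred _ _ := rfl
  qf _ _ := rfl
  prog _ _ := rfl
  hole _ := rfl
  dot i hi := by
    simp only [ArgSubst.adj]
    cases hτ : τ.dot i with
    | none => rfl
    | some θ =>
        exact (θ.eval_congr_state I fun v hv =>
          hE (disjoint_left.1 (h i θ hτ hi) hv)).symm

theorem Term.eval_plug (τ : ArgSubst L) (I : Interp L) : ∀ (θ : Term L), θ.PlugAdm τ →
    ∀ ν, (θ.plug τ).eval I ν = θ.eval (τ.adj I ν) ν
  | .var _, _, _ => rfl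
  | .num _, _, _ => rfl
  | .dot i, _, ν => by
      simp only [Term.plug, Term.eval, ArgSubst.adj]
      cases τ.dot i <;> rfl
  | .fn f args, h, ν => by
      simp only [Term.plug, Term.eval]
      simp only [fun i => (args i).eval_plug τ I (h i) ν]
      rfl
  | .add θ η, h, ν => by
      simp only [Term.plug, Term.eval, θ.eval_plug τ I h.1 ν, η.eval_plug τ I h.2 ν]
  | .mul θ η, h, ν => by
      simp only [Term.plug, Term.eval, θ.eval_plug τ I h.1 ν, η.eval_plug τ I h.2 ν]
  | .der θ, h, ν => by
      have key : (θ.plug τ).eval I = θ.eval (τ.adj I ν) := by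
        funext ω
        rw [θ.eval_plug τ I h.1 ω,
          θ.eval_congr_interp (ArgSubst.adj_agreeOn h.2 I (ν := ν) (by simp))]
      simp only [Term.plug, Term.eval, key]

mutual

theorem Formula.sat_plug (τ : ArgSubst L) (I : Interp L) : ∀ (φ : Formula L), φ.PlugAdm τ →
    ∀ ν, (φ.plug τ).sat I ν ↔ φ.sat (τ.adj I ν) ν
  | .ge θ η, h, ν => by
      simp only [Formula.plug, Formula.sat, θ.eval_plug τ I h.1 ν, η.eval_plug τ I h.2 ν]
  | .pred p args, h, ν => by
      simp only [Formula.plug, Formula.sat]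
      simp only [fun i => (args i).eval_plug τ I (h i) ν]
      rfl
  | .qf C φ, h, ν => by
      rw [Formula.PlugAdm] at h
      have key : ∀ ω, (φ.plug τ).sat I ω ↔ φ.sat (τ.adj I ν) ω := fun ω => by
        rw [φ.sat_plug τ I h.1 ω,
          φ.sat_congr_interp (ArgSubst.adj_agreeOn h.2 I (ν := ν) (by simp))]
      simp only [Formula.plug, Formula.sat, key]
      rfl
  | .hole, _, ν => by
      simp only [Formula.plug, Formula.sat, ArgSubst.adj]
      cases τ.hole <;> rfl
  | .neg φ, h, ν => by
      rw [Formula.PlugAdm] at h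
      simp only [Formula.plug, Formula.sat, φ.sat_plug τ I h ν]
  | .conj φ ψ, h, ν => by
      rw [Formula.PlugAdm] at h
      simp only [Formula.plug, Formula.sat, φ.sat_plug τ I h.1 ν, ψ.sat_plug τ I h.2 ν]
  | .all x φ, h, ν => by
      rw [Formula.PlugAdm] at h
      simp only [Formula.plug, Formula.sat]
      refine forall_congr' fun r => ?_
      rw [φ.sat_plug τ I h.1, φ.sat_congr_interp (ArgSubst.adj_agreeOn h.2 I (ν := ν)
        fun v hv => (State.upd_of_ne _ _ hv).symm)]
  | .ex x φ, h, ν => by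
      rw [Formula.PlugAdm] at h
      simp only [Formula.plug, Formula.sat]
      refine exists_congr fun r => ?_
      rw [φ.sat_plug τ I h.1, φ.sat_congr_interp (ArgSubst.adj_agreeOn h.2 I (ν := ν)
        fun v hv => (State.upd_of_ne _ _ hv).symm)]
  | .box α φ, h, ν => by
      rw [Formula.PlugAdm] at h
      simp only [Formula.plug, Formula.sat]
      refine forall_congr' fun ω => ?_
      rw [← α.run_plug τ I h.1]
      refine imp_congr_right fun hr => ?_
      rw [φ.sat_plug τ I h.2.1,
        φ.sat_congr_interp (ArgSubst.adj_agreeOn h.2.2 I (Prog.eqOn_compl_bv I _ hr))]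
  | .dia α φ, h, ν => by
      rw [Formula.PlugAdm] at h
      simp only [Formula.plug, Formula.sat]
      refine exists_congr fun ω => ?_
      rw [← α.run_plug τ I h.1]
      refine and_congr_right fun hr => ?_
      rw [φ.sat_plug τ I h.2.1,
        φ.sat_congr_interp (ArgSubst.adj_agreeOn h.2.2 I (Prog.eqOn_compl_bv I _ hr))]

theorem Prog.run_plug (τ : ArgSubst L) (I : Interp L) : ∀ (α : Prog L), α.PlugAdm τ →
    ∀ ν ω, (α.plug τ).run I ν ω ↔ α.run (τ.adj I ν) ν ω
  | .const _, _, _, _ => Iff.rfl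
  | .assign v θ, h, ν, ω => by
      rw [Prog.PlugAdm] at h
      simp only [Prog.plug, Prog.run, θ.eval_plug τ I h ν]
  | .test ψ, h, ν, ω => by
      rw [Prog.PlugAdm] at h
      simp only [Prog.plug, Prog.run, ψ.sat_plug τ I h ν]
  | .ode x θ ψ, h, ν, ω => by
      rw [Prog.PlugAdm] at h
      rw [Prog.plug]
      refine Prog.run_ode_congr (fun i μ hμ => ?_) fun μ hμ => ?_
      · rw [(θ i).eval_plug τ I (h.1 i).1,
          (θ i).eval_congr_interp (ArgSubst.adj_agreeOn (h.1 i).2 I hμ)]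
      · rw [ψ.sat_plug τ I h.2.1, ψ.sat_congr_interp (ArgSubst.adj_agreeOn h.2.2 I hμ)]
  | .choice α β, h, ν, ω => by
      rw [Prog.PlugAdm] at h
      simp only [Prog.plug, Prog.run, α.run_plug τ I h.1, β.run_plug τ I h.2]
  | .seq α β, h, ν, ω => by
      rw [Prog.PlugAdm] at h
      simp only [Prog.plug, Prog.run]
      refine exists_congr fun μ => ?_
      rw [← α.run_plug τ I h.1]
      refine and_congr_right fun hr => ?_
      rw [β.run_plug τ I h.2.1,
        β.run_congr_interp (ArgSubst.adj_agreeOn h.2.2 I (Prog.eqOn_compl_bv I _ hr))]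
  | .loop α, h, ν, ω => by
      rw [Prog.PlugAdm] at h
      simp only [Prog.plug, Prog.run]
      refine reflTransGen_iff_of_invariant (P := fun μ => EqOn ν μ (α.plug τ).bvᶜ)
        (eqOn_refl _ _) (fun _ _ h1 h2 => h1.trans (Prog.eqOn_compl_bv I _ h2)) fun μ μ' hμ => ?_
      rw [α.run_plug τ I h.1, α.run_congr_interp (ArgSubst.adj_agreeOn h.2 I hμ)]

end

/-! ## Uniform substitution -/

/-- The sequence `e` with its first `n` entries replaced by `d`. -/
def overwrite {n : ℕ} (d : Fin n → ℝ) (e : ℕ → ℝ) (i : ℕ) : ℝ :=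
  if h : i < n then d ⟨i, h⟩ else e i

theorem ArgSubst.ofArgs_adj {n : ℕ} (θ : Fin n → Term L) (I : Interp L) (ν : State L) :
    (ArgSubst.ofArgs θ).adj I ν =
      { I with dot := overwrite (fun i => (θ i).eval I ν) I.dot } := by
  simp only [ArgSubst.adj, ArgSubst.ofArgs, Option.elim_none]
  congr 1
  funext i
  by_cases h : i < n <;> simp [overwrite, h]

theorem contDiff_overwrite {n : ℕ} (e : ℕ → ℝ) (i : ℕ) :
    ContDiff ℝ ((⊤ : ℕ∞) : WithTop ℕ∞) fun d : Fin n → ℝ => overwrite d e i := by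
  by_cases h : i < n
  · simpa only [overwrite, h, dif_pos] using contDiff_apply ℝ ℝ _
  · simpa only [overwrite, h, dif_neg, not_false_eq_true] using contDiff_const

/-- The adjoint of a uniform substitution: the interpretation in which every symbol has the
meaning that its replacement has in `ν`. -/
noncomputable def USubst.adj (σ : USubst L) (I : Interp L) (ν : State L) : Interp L where
  fn f := (σ.fn f).elim (I.fn f) fun θ d => θ.eval { I with dot := overwrite d I.dot } ν
  fn_smooth f := by
    cases σ.fn f with
    | none => exact I.fn_smooth f
    | some θ =>
        exact θ.contDiff_eval I (fun d => overwrite d I.dot) (fun _ => ν)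
          (contDiff_overwrite I.dot) fun _ => contDiff_const
  pred p := (σ.pred p).elim (I.pred p)
    fun φ => {d | φ.sat { I with dot := overwrite d I.dot } ν}
  qf C := (σ.qf C).elim (I.qf C) fun φ R => {ω | φ.sat { I with hole := R } ω}
  prog a := (σ.const a).elim (I.prog a) fun α => α.run I
  dot := I.dot
  hole := I.hole

theorem USubst.adj_fn_of_eq_some {σ : USubst L} {n : ℕ} {f : L.Fn n} {θ : Term L}
    (h : σ.fn f = some θ) (I : Interp L) (ν : State L) :
    (σ.adj I ν).fn f = fun d => θ.eval { I with dot := overwrite d I.dot } ν := by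
  simp only [USubst.adj, h, Option.elim_some]

theorem USubst.adj_pred_of_eq_some {σ : USubst L} {n : ℕ} {p : L.Pred n} {φ : Formula L}
    (h : σ.pred p = some φ) (I : Interp L) (ν : State L) :
    (σ.adj I ν).pred p = {d | φ.sat { I with dot := overwrite d I.dot } ν} := by
  simp only [USubst.adj, h, Option.elim_some]

theorem USubst.adj_qf_of_eq_some {σ : USubst L} {C : L.Qf} {φ : Formula L}
    (h : σ.qf C = some φ) (I : Interp L) (ν : State L) :
    (σ.adj I ν).qf C = fun R => {ω | φ.sat { I with hole := R } ω} := by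
  simp only [USubst.adj, h, Option.elim_some]

theorem USubst.adj_qf_of_eq_none {σ : USubst L} {C : L.Qf}
    (h : σ.qf C = none) (I : Interp L) (ν : State L) :
    (σ.adj I ν).qf C = I.qf C := by
  simp only [USubst.adj, h, Option.elim_none]

theorem USubst.adj_agreeOn {σ : USubst L} {U : Set (VarSym L)} {T : Set (Symb L)}
    (h : σ.UAdm U T) (I : Interp L) {ν ω : State L} (hE : EqOn ν ω Uᶜ) :
    (σ.adj I ω).AgreeOn (σ.adj I ν) T where
  fn {n} f hf := by
    simp only [USubst.adj]
    cases hσ : σ.fn f with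
    | none => rfl
    | some θ =>
        funext d
        refine (θ.eval_congr_state _ fun v hv => hE fun hU => ?_).symm
        exact (h ▸ (⟨Or.inl ⟨n, f, θ, hσ, hf, hv⟩, hU⟩ : v ∈ σ.fvOn T ∩ U) :
          v ∈ (∅ : Set (VarSym L)))
  pred {n} p hp := by
    simp only [USubst.adj]
    cases hσ : σ.pred p with
    | none => rfl
    | some φ =>
        have hφ : EqOn ν ω φ.fv := fun v hv => hE fun hU =>
          (h ▸ (⟨Or.inr ⟨n, p, φ, hσ, hp, hv⟩, hU⟩ : v ∈ σ.fvOn T ∩ U) :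
            v ∈ (∅ : Set (VarSym L)))
        ext d
        exact ⟨φ.sat_congr_state _ (EqOn.symm hφ), φ.sat_congr_state _ hφ⟩
  qf _ _ := rfl
  prog _ _ := rfl
  dot _ _ := rfl
  hole _ := rfl

theorem Term.eval_subst (σ : USubst L) (I : Interp L) : ∀ (θ : Term L), θ.Adm σ →
    ∀ ν, (θ.subst σ).eval I ν = θ.eval (σ.adj I ν) ν
  | .var _, _, _ => rfl
  | .num _, _, _ => rfl
  | .dot _, _, _ => rfl
  | .fn f args, h, ν => by
      have hargs := fun i => (args i).eval_subst σ I (h.1 i) ν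
      simp only [Term.subst]
      cases hσ : σ.fn f with
      | none => simp only [Term.eval, hargs, USubst.adj, hσ, Option.elim_none]
      | some θ =>
          simp only []
          rw [θ.eval_plug _ I (h.2 θ hσ) ν, ArgSubst.ofArgs_adj]
          simp only [Term.eval, hargs, USubst.adj_fn_of_eq_some hσ]
  | .add θ η, h, ν => by
      simp only [Term.subst, Term.eval, θ.eval_subst σ I h.1 ν, η.eval_subst σ I h.2 ν]
  | .mul θ η, h, ν => by
      simp only [Term.subst, Term.eval, θ.eval_subst σ I h.1 ν, η.eval_subst σ I h.2 ν]
  | .der θ, h, ν => by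
      have key : (θ.subst σ).eval I = θ.eval (σ.adj I ν) := by
        funext ω
        rw [θ.eval_subst σ I h.1 ω,
          θ.eval_congr_interp (USubst.adj_agreeOn h.2 I (ν := ν) (by simp))]
      simp only [Term.subst, Term.eval, key]

mutual

theorem Formula.sat_subst (σ : USubst L) (I : Interp L) : ∀ (φ : Formula L), φ.Adm σ →
    ∀ ν, (φ.subst σ).sat I ν ↔ φ.sat (σ.adj I ν) ν
  | .ge θ η, h, ν => by
      simp only [Formula.subst, Formula.sat, θ.eval_subst σ I h.1 ν, η.eval_subst σ I h.2 ν]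
  | .pred p args, h, ν => by
      rw [Formula.Adm] at h
      have hargs := fun i => (args i).eval_subst σ I (h.1 i) ν
      simp only [Formula.subst]
      cases hσ : σ.pred p with
      | none => simp only [Formula.sat, hargs, USubst.adj, hσ, Option.elim_none]
      | some φ =>
          simp only []
          rw [φ.sat_plug _ I (h.2 φ hσ) ν, ArgSubst.ofArgs_adj]
          simp only [Formula.sat, hargs, USubst.adj_pred_of_eq_some hσ, mem_ofPred_eq]
  | .qf C φ, h, ν => by
      rw [Formula.Adm] at h
      have key : ∀ ω, (φ.subst σ).sat I ω ↔ φ.sat (σ.adj I ν) ω := fun ω => by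
        rw [φ.sat_subst σ I h.1 ω,
          φ.sat_congr_interp (USubst.adj_agreeOn h.2.1 I (ν := ν) (by simp))]
      simp only [Formula.subst]
      cases hσ : σ.qf C with
      | none =>
          simp only [Formula.sat, key, USubst.adj_qf_of_eq_none hσ]
      | some ψ =>
          simp only []
          rw [ψ.sat_plug _ I (h.2.2 ψ hσ) ν]
          simp only [Formula.sat, ArgSubst.adj, ArgSubst.ofFormula, Option.elim_none,
            Option.elim_some, key, USubst.adj_qf_of_eq_some hσ, mem_ofPred_eq]
  | .hole, _, _ => Iff.rfl
  | .neg φ, h, ν => by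
      rw [Formula.Adm] at h
      simp only [Formula.subst, Formula.sat, φ.sat_subst σ I h ν]
  | .conj φ ψ, h, ν => by
      rw [Formula.Adm] at h
      simp only [Formula.subst, Formula.sat, φ.sat_subst σ I h.1 ν, ψ.sat_subst σ I h.2 ν]
  | .all x φ, h, ν => by
      rw [Formula.Adm] at h
      simp only [Formula.subst, Formula.sat]
      refine forall_congr' fun r => ?_
      rw [φ.sat_subst σ I h.1, φ.sat_congr_interp (USubst.adj_agreeOn h.2 I (ν := ν)
        fun v hv => (State.upd_of_ne _ _ hv).symm)]
  | .ex x φ, h, ν => by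
      rw [Formula.Adm] at h
      simp only [Formula.subst, Formula.sat]
      refine exists_congr fun r => ?_
      rw [φ.sat_subst σ I h.1, φ.sat_congr_interp (USubst.adj_agreeOn h.2 I (ν := ν)
        fun v hv => (State.upd_of_ne _ _ hv).symm)]
  | .box α φ, h, ν => by
      rw [Formula.Adm] at h
      simp only [Formula.subst, Formula.sat]
      refine forall_congr' fun ω => ?_
      rw [← α.run_subst σ I h.1]
      refine imp_congr_right fun hr => ?_
      rw [φ.sat_subst σ I h.2.1,
        φ.sat_congr_interp (USubst.adj_agreeOn h.2.2 I (Prog.eqOn_compl_bv I _ hr))]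
  | .dia α φ, h, ν => by
      rw [Formula.Adm] at h
      simp only [Formula.subst, Formula.sat]
      refine exists_congr fun ω => ?_
      rw [← α.run_subst σ I h.1]
      refine and_congr_right fun hr => ?_
      rw [φ.sat_subst σ I h.2.1,
        φ.sat_congr_interp (USubst.adj_agreeOn h.2.2 I (Prog.eqOn_compl_bv I _ hr))]

theorem Prog.run_subst (σ : USubst L) (I : Interp L) : ∀ (α : Prog L), α.Adm σ →
    ∀ ν ω, (α.subst σ).run I ν ω ↔ α.run (σ.adj I ν) ν ω
  | .const a, _, ν, ω => by
      simp only [Prog.subst, Prog.run, USubst.adj]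
      cases σ.const a <;> simp [Prog.run]
  | .assign v θ, h, ν, ω => by
      rw [Prog.Adm] at h
      simp only [Prog.subst, Prog.run, θ.eval_subst σ I h ν]
  | .test ψ, h, ν, ω => by
      rw [Prog.Adm] at h
      simp only [Prog.subst, Prog.run, ψ.sat_subst σ I h ν]
  | .ode x θ ψ, h, ν, ω => by
      rw [Prog.Adm] at h
      rw [Prog.subst]
      refine Prog.run_ode_congr (fun i μ hμ => ?_) fun μ hμ => ?_
      · rw [(θ i).eval_subst σ I (h.1 i).1,
          (θ i).eval_congr_interp (USubst.adj_agreeOn (h.1 i).2 I hμ)]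
      · rw [ψ.sat_subst σ I h.2.1, ψ.sat_congr_interp (USubst.adj_agreeOn h.2.2 I hμ)]
  | .choice α β, h, ν, ω => by
      rw [Prog.Adm] at h
      simp only [Prog.subst, Prog.run, α.run_subst σ I h.1, β.run_subst σ I h.2]
  | .seq α β, h, ν, ω => by
      rw [Prog.Adm] at h
      simp only [Prog.subst, Prog.run]
      refine exists_congr fun μ => ?_
      rw [← α.run_subst σ I h.1]
      refine and_congr_right fun hr => ?_
      rw [β.run_subst σ I h.2.1,
        β.run_congr_interp (USubst.adj_agreeOn h.2.2 I (Prog.eqOn_compl_bv I _ hr))]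
  | .loop α, h, ν, ω => by
      rw [Prog.Adm] at h
      simp only [Prog.subst, Prog.run]
      refine reflTransGen_iff_of_invariant (P := fun μ => EqOn ν μ (α.subst σ).bvᶜ)
        (eqOn_refl _ _) (fun _ _ h1 h2 => h1.trans (Prog.eqOn_compl_bv I _ h2)) fun μ μ' hμ => ?_
      rw [α.run_subst σ I h.1, α.run_congr_interp (USubst.adj_agreeOn h.2 I hμ)]

end

/-- Soundness of the uniform substitution rule. -/
theorem Formula.Valid.subst {φ : Formula L} {σ : USubst L} (h : φ.Valid) (hσ : φ.Adm σ) :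
    (φ.subst σ).Valid := fun I ν => (φ.sat_subst σ I hσ ν).2 (h _ ν)

theorem USubst.adj_eq_of_fv_eq_empty {σ : USubst L} (h : σ.fv = ∅) (I : Interp L)
    (φ : Formula L) (ν ω : State L) : φ.sat (σ.adj I ν) = φ.sat (σ.adj I ω) := by
  refine φ.sat_congr_interp (Interp.AgreeOn.mono (T := univ) ?_ (subset_univ _))
  refine USubst.adj_agreeOn (U := univ) ?_ I (by simp)
  rw [USubst.UAdm, ← USubst.fv, h, empty_inter]

theorem Formula.validIn_subst_iff {σ : USubst L} (h : σ.fv = ∅) (I : Interp L) {φ : Formula L}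
    (hφ : φ.Adm σ) (μ : State L) : (φ.subst σ).ValidIn I ↔ φ.ValidIn (σ.adj I μ) :=
  forall_congr' fun ν => by
    rw [φ.sat_subst σ I hφ ν, USubst.adj_eq_of_fv_eq_empty h I φ ν μ]

theorem Rule.LocallySound.sound {R : Rule L} (h : R.LocallySound) : R.Sound :=
  fun hp I => h I fun φ hφ => hp φ hφ I

theorem Rule.LocallySound.subst {R : Rule L} {σ : USubst L} (h : R.LocallySound)
    (hσ : σ.fv = ∅) (hR : R.Adm σ) : (R.subst σ).LocallySound := by
  intro I hp
  refine (Formula.validIn_subst_iff hσ I hR.2 fun _ => 0).2 (h _ fun φ hφ => ?_)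
  exact (Formula.validIn_subst_iff hσ I (hR.1 φ hφ) fun _ => 0).1
    (hp _ (List.mem_map_of_mem hφ))

/-! ## Semantics of the defined operators -/

theorem Formula.sat_imp (I : Interp L) (φ ψ : Formula L) (ν : State L) :
    (φ.imp ψ).sat I ν ↔ (φ.sat I ν → ψ.sat I ν) := by
  simp only [Formula.imp, Formula.sat]
  tauto

theorem Formula.sat_iff (I : Interp L) (φ ψ : Formula L) (ν : State L) :
    (φ.iff ψ).sat I ν ↔ (φ.sat I ν ↔ ψ.sat I ν) := by
  simp only [Formula.iff, Formula.sat, Formula.sat_imp]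
  tauto

theorem sat_rel_eq (I : Interp L) (θ η : Term L) (ν : State L) :
    (Cmp.rel .eq θ η).sat I ν ↔ θ.eval I ν = η.eval I ν := by
  simp only [Cmp.rel, Formula.sat]
  exact ⟨fun h => le_antisymm h.2 h.1, fun h => ⟨h.ge, h.le⟩⟩

theorem eval_tv (I : Interp L) (x : L.Var) (ν : State L) : (tv x).eval I ν = ν (.base x) := rfl

theorem eval_td (I : Interp L) (x : L.Var) (ν : State L) : (td x).eval I ν = ν (.prime x) := rfl

/-- The interpretation of a unary function symbol. -/
def Interp.fn1 (I : Interp L) (f : L.Fn 1) (X : ℝ) : ℝ := I.fn f ![X]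

/-- The interpretation of a unary predicate symbol. -/
def Interp.pred1 (I : Interp L) (p : L.Pred 1) (X : ℝ) : Prop := ![X] ∈ I.pred p

theorem eval_fn0 (I : Interp L) (f : L.Fn 0) (ν : State L) :
    (fn0 f).eval I ν = I.fn f ![] := by
  simp only [fn0, Term.eval]
  congr 1
  exact Subsingleton.elim _ _

theorem eval_fn1 (I : Interp L) (f : L.Fn 1) (θ : Term L) (ν : State L) :
    (fn1 f θ).eval I ν = I.fn1 f (θ.eval I ν) := by
  simp only [DL.fn1, Term.eval, Interp.fn1]
  congr 1
  funext i
  fin_cases i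
  rfl

theorem sat_pr0 (I : Interp L) (p : L.Pred 0) (ν : State L) :
    (pr0 p).sat I ν ↔ ![] ∈ I.pred p := by
  simp only [pr0, Formula.sat]
  rw [Subsingleton.elim (fun i : Fin 0 => (![] i : Term L).eval I ν) ![]]

theorem sat_pr1 (I : Interp L) (p : L.Pred 1) (θ : Term L) (ν : State L) :
    (pr1 p θ).sat I ν ↔ I.pred1 p (θ.eval I ν) := by
  simp only [pr1, Formula.sat, Interp.pred1]
  rw [show (fun i : Fin 1 => (![θ] i).eval I ν) = ![θ.eval I ν] from
    funext fun i => by fin_cases i; rfl]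

theorem sat_box_assign (I : Interp L) (v : VarSym L) (θ : Term L) (φ : Formula L) (ν : State L) :
    (Formula.box (.assign v θ) φ).sat I ν ↔ φ.sat I (ν.upd v (θ.eval I ν)) := by
  simp only [Formula.sat, Prog.run, forall_eq]

/-! ## Differentials -/

/-- The differential of a term whose value depends on a single variable. -/
theorem eval_der_of_single (I : Interp L) {θ : Term L} {x : L.Var} {g : ℝ → ℝ}
    (hθ : ∀ μ : State L, θ.eval I μ = g (μ (.base x))) (ν : State L) :
    (Term.der θ).eval I ν = ν (.prime x) * deriv g (ν (.base x)) := by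
  simp only [Term.eval, hθ]
  rw [finsum_eq_single _ x]
  · simp only [State.upd_same]
  · intro y hy
    have : VarSym.base x ≠ VarSym.base y := fun h => hy (by injection h with h; exact h.symm)
    simp [State.upd_of_ne _ _ this]

theorem Interp.differentiable_fn1 (I : Interp L) (f : L.Fn 1) :
    Differentiable ℝ (I.fn1 f) := by
  refine ((I.fn_smooth f).differentiable (by simp)).comp (differentiable_pi.2 fun i => ?_)
  fin_cases i
  exact differentiable_id

theorem eval_der_add (I : Interp L) (θ η : Term L) (ν : State L) :
    (Term.der (.add θ η)).eval I ν = (Term.der θ).eval I ν + (Term.der η).eval I ν := by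
  simp only [Term.eval]
  rw [← finsum_add_distrib ((Finset.finite_toSet _).subset (θ.support_der_subset I ν))
    ((Finset.finite_toSet _).subset (η.support_der_subset I ν))]
  refine finsum_congr fun x => ?_
  rw [← mul_add, deriv_fun_add (θ.differentiable_eval_upd I ν x _)
    (η.differentiable_eval_upd I ν x _)]

theorem eval_der_mul (I : Interp L) (θ η : Term L) (ν : State L) :
    (Term.der (.mul θ η)).eval I ν =
      (Term.der θ).eval I ν * η.eval I ν + θ.eval I ν * (Term.der η).eval I ν := by
  simp only [Term.eval]
  have h1 := (Finset.finite_toSet _).subset (θ.support_der_subset I ν)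
  have h2 := (Finset.finite_toSet _).subset (η.support_der_subset I ν)
  rw [finsum_mul' _ _ h1, mul_finsum' _ _ h2, ← finsum_add_distrib
    (h1.subset (Function.support_mul_subset_left _ _))
    (h2.subset (Function.support_mul_subset_right _ _))]
  refine finsum_congr fun x => ?_
  rw [deriv_fun_mul (θ.differentiable_eval_upd I ν x _)
    (η.differentiable_eval_upd I ν x _)]
  simp only [State.upd_self]
  ring

/-! ## Differential equations in one variable -/

/-- `X` solves `X' = f(X)` on `[0, r]` with initial value `a` inside the domain `q`. -/
structure IsSolution (f : ℝ → ℝ) (q : ℝ → Prop) (a r : ℝ) (X : ℝ → ℝ) : Prop where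
  nonneg : 0 ≤ r
  init : X 0 = a
  deriv : ∀ ζ ∈ Icc (0 : ℝ) r, HasDerivWithinAt X (f (X ζ)) (Icc 0 r) ζ
  domain : ∀ ζ ∈ Icc (0 : ℝ) r, q (X ζ)

theorem IsSolution.restrict {f : ℝ → ℝ} {q : ℝ → Prop} {a r : ℝ} {X : ℝ → ℝ}
    (h : IsSolution f q a r X) {s : ℝ} (hs : s ∈ Icc 0 r) : IsSolution f q a s X where
  nonneg := hs.1
  init := h.init
  deriv ζ hζ := (h.deriv ζ ⟨hζ.1, hζ.2.trans hs.2⟩).mono (Icc_subset_Icc_right hs.2)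
  domain ζ hζ := h.domain ζ ⟨hζ.1, hζ.2.trans hs.2⟩

theorem IsSolution.right_mem {f : ℝ → ℝ} {q : ℝ → Prop} {a r : ℝ} {X : ℝ → ℝ}
    (h : IsSolution f q a r X) : r ∈ Icc 0 r := ⟨h.nonneg, le_rfl⟩

theorem IsSolution.left_mem {f : ℝ → ℝ} {q : ℝ → Prop} {a r : ℝ} {X : ℝ → ℝ}
    (h : IsSolution f q a r X) : (0 : ℝ) ∈ Icc 0 r := ⟨le_rfl, h.nonneg⟩

theorem run_ode1_iff {I : Interp L} {x : L.Var} {θ : Term L} {ψ : Formula L} {f : ℝ → ℝ}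
    {q : ℝ → Prop} (hθ : ∀ μ : State L, θ.eval I μ = f (μ (.base x)))
    (hψ : ∀ μ : State L, ψ.sat I μ ↔ q (μ (.base x))) {ν ω : State L} :
    (ode1 x θ ψ).run I ν ω ↔ ∃ r X, IsSolution f q (ν (.base x)) r X ∧
      ω = (ν.upd (.base x) (X r)).upd (.prime x) (f (X r)) := by
  simp only [ode1, Prog.run, Fin.forall_fin_one, Function.Embedding.coeFn_mk,
    Matrix.cons_val_fin_one, hθ, hψ]
  constructor
  · rintro ⟨r, flow, hr, h0, rfl, h⟩
    refine ⟨r, fun t => flow t (.base x), ⟨hr, h0 _ (by simp), fun ζ hζ => ?_, fun ζ hζ =>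
      (h ζ hζ).2.2.1⟩, ?_⟩
    · rw [← (h ζ hζ).2.1]
      exact (h ζ hζ).1
    · funext v
      by_cases hv' : v = .prime x
      · subst hv'
        rw [State.upd_same, (h r ⟨hr, le_rfl⟩).2.1]
      · rw [State.upd_of_ne _ _ hv']
        by_cases hv : v = .base x
        · subst hv
          rw [State.upd_same]
        · rw [State.upd_of_ne _ _ hv]
          exact (h r ⟨hr, le_rfl⟩).2.2.2 v ⟨hv, hv'⟩
  · rintro ⟨r, X, hX, rfl⟩
    have hb : ∀ t, (((ν.upd (.base x) (X t)).upd (.prime x) (f (X t))) : State L) (.base x) =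
        X t := fun t => by
      rw [State.upd_of_ne _ _ (by simp), State.upd_same]
    refine ⟨r, fun t => (ν.upd (.base x) (X t)).upd (.prime x) (f (X t)), hX.nonneg,
      fun v hv => ?_, rfl, fun ζ hζ => ⟨?_, ?_, ?_, fun v hv => ?_⟩⟩
    · simp only [State.upd_of_ne _ _ hv, hX.init, State.upd_self]
    · simp only [hb, State.upd_same]
      exact hX.deriv ζ hζ
    · simp only [hb, State.upd_same]
    · simp only [hb]
      exact hX.domain ζ hζ
    · simp only [State.upd_of_ne _ _ hv.2, State.upd_of_ne _ _ hv.1]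

theorem sat_box_ode1_iff {I : Interp L} {x : L.Var} {θ : Term L} {ψ : Formula L} {f : ℝ → ℝ}
    {q : ℝ → Prop} (hθ : ∀ μ : State L, θ.eval I μ = f (μ (.base x)))
    (hψ : ∀ μ : State L, ψ.sat I μ ↔ q (μ (.base x))) {φ : Formula L} {ν : State L} :
    (Formula.box (ode1 x θ ψ) φ).sat I ν ↔ ∀ r X, IsSolution f q (ν (.base x)) r X →
      φ.sat I ((ν.upd (.base x) (X r)).upd (.prime x) (f (X r))) := by
  simp only [Formula.sat, run_ode1_iff hθ hψ]
  constructor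
  · exact fun h r X hX => h _ ⟨r, X, hX, rfl⟩
  · rintro h _ ⟨r, X, hX, rfl⟩
    exact h r X hX

theorem sat_box_ode1_iff_of_single {I : Interp L} {x : L.Var} {θ : Term L} {ψ : Formula L}
    {f : ℝ → ℝ} {q : ℝ → Prop} (hθ : ∀ μ : State L, θ.eval I μ = f (μ (.base x)))
    (hψ : ∀ μ : State L, ψ.sat I μ ↔ q (μ (.base x))) {φ : Formula L} {p : ℝ → Prop}
    (hφ : ∀ μ : State L, φ.sat I μ ↔ p (μ (.base x))) {ν : State L} :
    (Formula.box (ode1 x θ ψ) φ).sat I ν ↔ ∀ r X, IsSolution f q (ν (.base x)) r X → p (X r) := by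
  rw [sat_box_ode1_iff hθ hψ]
  refine forall_congr' fun r => forall_congr' fun X => imp_congr_right fun _ => ?_
  rw [hφ, State.upd_of_ne _ _ (by simp), State.upd_same]

theorem run_ode2_iff {I : Interp L} {x y : L.Var} (hxy : x ≠ y) {θ η : Term L} {ψ : Formula L}
    {ν ω : State L} : (ode2 x y hxy θ η ψ).run I ν ω ↔
      ∃ (r : ℝ) (flow : ℝ → State L), 0 ≤ r ∧
        (∀ v, v ≠ .prime x ∧ v ≠ .prime y → flow 0 v = ν v) ∧
        flow r = ω ∧
        ∀ ζ ∈ Icc (0 : ℝ) r,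
          (HasDerivWithinAt (fun t => flow t (.base x)) (flow ζ (.prime x)) (Icc 0 r) ζ ∧
            HasDerivWithinAt (fun t => flow t (.base y)) (flow ζ (.prime y)) (Icc 0 r) ζ) ∧
          (flow ζ (.prime x) = θ.eval I (flow ζ) ∧ flow ζ (.prime y) = η.eval I (flow ζ)) ∧
          ψ.sat I (flow ζ) ∧
          (∀ v, (v ≠ .base x ∧ v ≠ .prime x) ∧ (v ≠ .base y ∧ v ≠ .prime y) → flow ζ v = ν v) := by
  unfold ode2
  rw [Prog.run]
  simp only [Fin.forall_fin_two]
  rfl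

/-! ## Real analysis -/

theorem sub_le_sub_of_hasDerivWithinAt_le {r : ℝ} (hr : 0 ≤ r) {G H G' H' : ℝ → ℝ}
    (hG : ∀ ζ ∈ Icc (0 : ℝ) r, HasDerivWithinAt G (G' ζ) (Icc 0 r) ζ)
    (hH : ∀ ζ ∈ Icc (0 : ℝ) r, HasDerivWithinAt H (H' ζ) (Icc 0 r) ζ)
    (h : ∀ ζ ∈ Icc (0 : ℝ) r, H' ζ ≤ G' ζ) : G 0 - H 0 ≤ G r - H r := by
  have hd : ∀ ζ ∈ Icc (0 : ℝ) r,
      HasDerivWithinAt (fun t => G t - H t) (G' ζ - H' ζ) (Icc 0 r) ζ :=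
    fun ζ hζ => (hG ζ hζ).sub (hH ζ hζ)
  have hd' : ∀ ζ ∈ interior (Icc (0 : ℝ) r), HasDerivAt (fun t => G t - H t) (G' ζ - H' ζ) ζ :=
    fun ζ hζ => (hd ζ (interior_subset hζ)).hasDerivAt (mem_interior_iff_mem_nhds.1 hζ)
  refine monotoneOn_of_deriv_nonneg (convex_Icc 0 r) (fun ζ hζ => (hd ζ hζ).continuousWithinAt)
    (fun ζ hζ => (hd' ζ hζ).differentiableAt.differentiableWithinAt) (fun ζ hζ => ?_)
    ⟨le_rfl, hr⟩ ⟨hr, le_rfl⟩ hr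
  rw [(hd' ζ hζ).deriv]
  exact sub_nonneg.2 (h ζ (interior_subset hζ))

/-- Scalar linear differential equations have global solutions. -/
theorem exists_solution_linear {r : ℝ} (hr : 0 ≤ r) {α β : ℝ → ℝ}
    (hα : ContinuousOn α (Icc 0 r)) (hβ : ContinuousOn β (Icc 0 r)) (c : ℝ) :
    ∃ Y : ℝ → ℝ, Y 0 = c ∧
      ∀ ζ ∈ Icc (0 : ℝ) r, HasDerivWithinAt Y (α ζ * Y ζ + β ζ) (Icc 0 r) ζ := by
  have hα' : Continuous (IccExtend hr ((Icc 0 r).domRestrict α)) :=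
    (continuousOn_iff_continuous_domRestrict.1 hα).Icc_extend'
  have hβ' : Continuous (IccExtend hr ((Icc 0 r).domRestrict β)) :=
    (continuousOn_iff_continuous_domRestrict.1 hβ).Icc_extend'
  set a := IccExtend hr ((Icc 0 r).domRestrict α) with ha
  set b := IccExtend hr ((Icc 0 r).domRestrict β) with hb
  have hA : ∀ t, HasDerivAt (fun t => ∫ s in (0 : ℝ)..t, a s) (a t) t := fun t =>
    hα'.integral_hasStrictDerivAt 0 t |>.hasDerivAt
  set A := fun t => ∫ s in (0 : ℝ)..t, a s with hAdef
  have hAc : Continuous A := continuous_iff_continuousAt.2 fun t => (hA t).continuousAt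
  have hB : ∀ t, HasDerivAt (fun t => ∫ s in (0 : ℝ)..t, Real.exp (-A s) * b s)
      (Real.exp (-A t) * b t) t := fun t =>
    ((Real.continuous_exp.comp hAc.neg).mul hβ').integral_hasStrictDerivAt 0 t |>.hasDerivAt
  refine ⟨fun t => Real.exp (A t) * (c + ∫ s in (0 : ℝ)..t, Real.exp (-A s) * b s), ?_,
    fun ζ hζ => ?_⟩
  · simp [hAdef]
  · have h := ((hA ζ).exp.mul ((hB ζ).const_add c)).hasDerivWithinAt (s := Icc 0 r)
    refine h.congr_deriv ?_
    have haζ : a ζ = α ζ := by rw [ha, IccExtend_of_mem hr _ hζ]; rfl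
    have hbζ : b ζ = β ζ := by rw [hb, IccExtend_of_mem hr _ hζ]; rfl
    have he : Real.exp (A ζ) * Real.exp (-A ζ) = 1 := by
      rw [← Real.exp_add, add_neg_cancel, Real.exp_zero]
    rw [haζ, hbζ, ← mul_assoc (Real.exp (A ζ)) (Real.exp (-A ζ)), he]
    ring

/-! ## Validity of the axioms -/

theorem valid_differential_weakening (x : L.Var) (f : L.Fn 1) (q : L.Pred 1) :
    (Formula.box (ode1 x (fn1 f (tv x)) (pr1 q (tv x))) (pr1 q (tv x))).Valid := by
  intro I ν
  rw [sat_box_ode1_iff_of_single (fun μ => eval_fn1 I f (tv x) μ)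
    (fun μ => sat_pr1 I q (tv x) μ) (fun μ => sat_pr1 I q (tv x) μ)]
  exact fun r X hX => hX.domain r hX.right_mem

theorem valid_differential_cut (x : L.Var) (f : L.Fn 1) (p q r : L.Pred 1) :
    (Formula.imp (.box (ode1 x (fn1 f (tv x)) (pr1 q (tv x))) (pr1 r (tv x)))
      (.iff (.box (ode1 x (fn1 f (tv x)) (pr1 q (tv x))) (pr1 p (tv x)))
        (.box (ode1 x (fn1 f (tv x)) (.conj (pr1 q (tv x)) (pr1 r (tv x))))
          (pr1 p (tv x))))).Valid := by
  intro I ν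
  have hf : ∀ μ : State L, (fn1 f (tv x)).eval I μ = I.fn1 f (μ (.base x)) :=
    fun μ => eval_fn1 I f (tv x) μ
  have hs : ∀ (p : L.Pred 1) (μ : State L), (pr1 p (tv x)).sat I μ ↔ I.pred1 p (μ (.base x)) :=
    fun p μ => sat_pr1 I p (tv x) μ
  rw [Formula.sat_imp, Formula.sat_iff, sat_box_ode1_iff_of_single hf (hs q) (hs r),
    sat_box_ode1_iff_of_single hf (hs q) (hs p),
    sat_box_ode1_iff_of_single hf (q := fun X => I.pred1 q X ∧ I.pred1 r X)
      (fun μ => by rw [Formula.sat, hs, hs]) (hs p)]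
  refine fun hr => ⟨fun h s X hX => h s X ⟨hX.nonneg, hX.init, hX.deriv,
    fun ζ hζ => (hX.domain ζ hζ).1⟩, fun h s X hX => h s X ⟨hX.nonneg, hX.init, hX.deriv,
    fun ζ hζ => ⟨hX.domain ζ hζ, hr ζ X (hX.restrict hζ)⟩⟩⟩

theorem valid_differential_effect (x : L.Var) (f : L.Fn 1) (q : L.Pred 1) (φ : Formula L) :
    (Formula.iff (.box (ode1 x (fn1 f (tv x)) (pr1 q (tv x))) φ)
      (.box (ode1 x (fn1 f (tv x)) (pr1 q (tv x)))
        (.box (.assign (.prime x) (fn1 f (tv x))) φ))).Valid := by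
  intro I ν
  have hf : ∀ μ : State L, (fn1 f (tv x)).eval I μ = I.fn1 f (μ (.base x)) :=
    fun μ => eval_fn1 I f (tv x) μ
  rw [Formula.sat_iff, sat_box_ode1_iff hf (fun μ => sat_pr1 I q (tv x) μ),
    sat_box_ode1_iff hf (fun μ => sat_pr1 I q (tv x) μ)]
  refine forall_congr' fun r => forall_congr' fun X => imp_congr_right fun _ => ?_
  rw [sat_box_assign, hf]
  have h : ((ν.upd (.base x) (X r)).upd (.prime x) (I.fn1 f (X r)) : State L) (.prime x) =
      I.fn1 f (X r) := State.upd_same _ _ _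
  have h' : ((ν.upd (.base x) (X r)).upd (.prime x) (I.fn1 f (X r)) : State L) (.base x) =
      X r := by rw [State.upd_of_ne _ _ (by simp), State.upd_same]
  rw [h']
  nth_rw 3 [← h]
  rw [State.upd_self]

theorem valid_differential_invariant (x : L.Var) (f : L.Fn 1) (q : L.Pred 1) (c : Cmp)
    (g h : L.Fn 1) :
    (Formula.imp
      (.imp (pr1 q (tv x))
        (.conj (c.rel (fn1 g (tv x)) (fn1 h (tv x)))
          (.box (ode1 x (fn1 f (tv x)) (pr1 q (tv x)))
            (c.relDer (fn1 g (tv x)) (fn1 h (tv x))))))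
      (.box (ode1 x (fn1 f (tv x)) (pr1 q (tv x)))
        (c.rel (fn1 g (tv x)) (fn1 h (tv x))))).Valid := by
  intro I ν
  have hf : ∀ (f : L.Fn 1) (μ : State L), (fn1 f (tv x)).eval I μ = I.fn1 f (μ (.base x)) :=
    fun f μ => eval_fn1 I f (tv x) μ
  have hd : ∀ (g : L.Fn 1) (μ : State L), (Term.der (fn1 g (tv x))).eval I μ =
      μ (.prime x) * deriv (I.fn1 g) (μ (.base x)) :=
    fun g => eval_der_of_single I (hf g)
  rw [Formula.sat_imp, Formula.sat_imp, Formula.sat,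
    sat_box_ode1_iff (hf f) (fun μ => sat_pr1 I q (tv x) μ),
    sat_box_ode1_iff (hf f) (fun μ => sat_pr1 I q (tv x) μ), sat_pr1]
  intro hyp r X hX
  obtain ⟨h0, hder⟩ := hyp (by simpa only [hX.init, eval_tv] using hX.domain 0 hX.left_mem)
  have hder' := fun ζ hζ => hder ζ X (hX.restrict hζ)
  have hG : ∀ (g : L.Fn 1), ∀ ζ ∈ Icc (0 : ℝ) r, HasDerivWithinAt (fun t => I.fn1 g (X t))
      (I.fn1 f (X ζ) * deriv (I.fn1 g) (X ζ)) (Icc 0 r) ζ := fun g ζ hζ => by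
    rw [mul_comm]
    exact (I.differentiable_fn1 g (X ζ)).hasDerivAt.comp_hasDerivWithinAt ζ (hX.deriv ζ hζ)
  have hup : ∀ s, ((ν.upd (.base x) (X s)).upd (.prime x) (I.fn1 f (X s)) : State L) (.base x) =
      X s := fun s => by rw [State.upd_of_ne _ _ (by simp), State.upd_same]
  have hle := sub_le_sub_of_hasDerivWithinAt_le hX.nonneg (hG g) (hG h)
  have hge := sub_le_sub_of_hasDerivWithinAt_le hX.nonneg (hG h) (hG g)
  simp only [hX.init] at hle hge
  cases c <;>
    simp only [Cmp.rel, Cmp.relDer, Formula.sat, hf, hd, hup, State.upd_same] at h0 hder' ⊢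
  · linarith [hle hder']
  · linarith [hle hder']
  · linarith [hge hder']
  · linarith [hge hder']
  · have h1 := hle fun ζ hζ => (hder' ζ hζ).1
    have h2 := hge fun ζ hζ => (hder' ζ hζ).2
    constructor <;> linarith [h0.1, h0.2]
  · have h1 := hle fun ζ hζ => (hder' ζ hζ).1
    have h2 := hge fun ζ hζ => (hder' ζ hζ).2
    exact fun h => h0 ⟨by linarith [h.1, h.2], by linarith [h.1, h.2]⟩

theorem valid_differential_ghost (x y : L.Var) (hxy : x ≠ y) (f a b : L.Fn 1) (p q : L.Pred 1) :
    (Formula.iff (.box (ode1 x (fn1 f (tv x)) (pr1 q (tv x))) (pr1 p (tv x)))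
      (.ex y (.box
        (ode2 x y hxy (fn1 f (tv x)) (.add (.mul (fn1 a (tv x)) (tv y)) (fn1 b (tv x)))
          (pr1 q (tv x)))
        (pr1 p (tv x))))).Valid := by
  intro I ν
  have hf : ∀ (f : L.Fn 1) (μ : State L), (fn1 f (tv x)).eval I μ = I.fn1 f (μ (.base x)) :=
    fun f μ => eval_fn1 I f (tv x) μ
  have hs : ∀ (p : L.Pred 1) (μ : State L), (pr1 p (tv x)).sat I μ ↔ I.pred1 p (μ (.base x)) :=
    fun p μ => sat_pr1 I p (tv x) μ
  rw [Formula.sat_iff, sat_box_ode1_iff_of_single (hf f) (hs q) (hs p)]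
  have hne : VarSym.base x ≠ VarSym.base y := by simpa using hxy
  have hne' : VarSym.prime x ≠ VarSym.prime y := by simpa using hxy
  simp only [Formula.sat, run_ode2_iff, hs, hf, Term.eval, eval_tv]
  constructor
  · intro h
    refine ⟨0, ?_⟩
    rintro _ ⟨r, flow, hr, h0, rfl, hflow⟩
    refine h r (fun t => flow t (.base x)) ⟨hr, ?_, fun ζ hζ => ?_, fun ζ hζ => (hflow ζ hζ).2.2.1⟩
    · rw [h0 _ (by simp), State.upd_of_ne _ _ hne]
    · rw [← (hflow ζ hζ).2.1.1]
      exact (hflow ζ hζ).1.1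
  · rintro ⟨c, h⟩ r X hX
    have hXc : ContinuousOn X (Icc 0 r) := fun ζ hζ => (hX.deriv ζ hζ).continuousWithinAt
    obtain ⟨Y, hY0, hY⟩ := exists_solution_linear hX.nonneg
      ((I.differentiable_fn1 a).continuous.comp_continuousOn hXc)
      ((I.differentiable_fn1 b).continuous.comp_continuousOn hXc) c
    let flow : ℝ → State L := fun t =>
      (((ν.upd (.base x) (X t)).upd (.base y) (Y t)).upd (.prime x) (I.fn1 f (X t))).upd
        (.prime y) (I.fn1 a (X t) * Y t + I.fn1 b (X t))
    have hbx : ∀ t, flow t (.base x) = X t := fun t => by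
      simp only [flow]
      rw [State.upd_of_ne _ _ (by simp), State.upd_of_ne _ _ (by simp), State.upd_of_ne _ _ hne,
        State.upd_same]
    have hby : ∀ t, flow t (.base y) = Y t := fun t => by
      simp only [flow]
      rw [State.upd_of_ne _ _ (by simp), State.upd_of_ne _ _ (by simp), State.upd_same]
    have hpx : ∀ t, flow t (.prime x) = I.fn1 f (X t) := fun t => by
      simp only [flow]
      rw [State.upd_of_ne _ _ hne', State.upd_same]
    have hpy : ∀ t, flow t (.prime y) = I.fn1 a (X t) * Y t + I.fn1 b (X t) := fun t =>
      State.upd_same _ _ _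
    have hout : ∀ t v, v ≠ .base x → v ≠ .base y → v ≠ .prime x → v ≠ .prime y →
        flow t v = ν v := fun t v h1 h2 h3 h4 => by
      simp only [flow]
      rw [State.upd_of_ne _ _ h4, State.upd_of_ne _ _ h3, State.upd_of_ne _ _ h2,
        State.upd_of_ne _ _ h1]
    rw [← hbx r]
    refine h _ ⟨r, flow, hX.nonneg, fun v hv => ?_, rfl, fun ζ hζ => ⟨⟨?_, ?_⟩, ⟨?_, ?_⟩, ?_,
      fun v hv => ?_⟩⟩
    · by_cases hvy : v = .base y
      · subst hvy
        rw [hby, hY0, State.upd_same]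
      · rw [State.upd_of_ne _ _ hvy]
        by_cases hvx : v = .base x
        · subst hvx
          rw [hbx, hX.init]
        · exact hout 0 v hvx hvy hv.1 hv.2
    · simp only [hbx, hpx]
      exact hX.deriv ζ hζ
    · simp only [hby, hpy]
      exact hY ζ hζ
    · rw [hpx, hbx]
    · rw [hpy, hbx, hby]
    · rw [hbx]
      exact hX.domain ζ hζ
    · rw [State.upd_of_ne _ _ hv.2.1]
      exact hout ζ v hv.1.1 hv.2.1 hv.1.2 hv.2.2

theorem valid_differential_solution (x t s : L.Var) (hxt : x ≠ t) (hxs : x ≠ s) (hts : t ≠ s)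
    (f : L.Fn 0) (p q : L.Pred 1) :
    (Formula.iff (.box (ode1 x (fn0 f) (pr1 q (tv x))) (pr1 p (tv x)))
      (.all t (.imp (.ge (tv t) (.num 0))
        (.imp
          (.all s (.imp (.conj (.ge (tv s) (.num 0)) (.ge (tv t) (tv s)))
            (pr1 q (.add (tv x) (.mul (fn0 f) (tv s))))))
          (.box (.assign (.base x) (.add (tv x) (.mul (fn0 f) (tv t))))
            (pr1 p (tv x))))))).Valid := by
  intro I ν
  have h1 : VarSym.base x ≠ VarSym.base t := by simpa using hxt
  have h2 : VarSym.base x ≠ VarSym.base s := by simpa using hxs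
  have h3 : VarSym.base t ≠ VarSym.base s := by simpa using hts
  rw [Formula.sat_iff, sat_box_ode1_iff_of_single (f := fun _ => I.fn f ![])
    (fun μ => eval_fn0 I f μ) (fun μ => sat_pr1 I q (tv x) μ) (fun μ => sat_pr1 I p (tv x) μ)]
  rw [Formula.sat]
  simp only [Formula.sat_imp, sat_box_assign, sat_pr1, eval_tv, State.upd_same]
  simp only [Formula.sat, Formula.sat_imp, sat_pr1, Term.eval, eval_tv, eval_fn0,
    State.upd_same, State.upd_of_ne _ _ h1, State.upd_of_ne _ _ h2, State.upd_of_ne _ _ h3,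
    Rat.cast_zero]
  set k := I.fn f ![]
  constructor
  · intro h r hr hq
    refine h r (fun ζ => ν (.base x) + k * ζ) ⟨hr, by simp, fun ζ _ => ?_, fun ζ hζ => hq ζ hζ⟩
    exact (((hasDerivAt_id ζ).const_mul k).const_add _).hasDerivWithinAt.congr_deriv (by simp)
  · intro h r X hX
    have hlin : ∀ ζ ∈ Icc (0 : ℝ) r, X ζ = ν (.base x) + k * ζ := by
      intro ζ hζ
      have hX' := hX.restrict hζ
      have hl : ∀ z ∈ Icc (0 : ℝ) ζ, HasDerivWithinAt (fun z => k * z) k (Icc 0 ζ) z :=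
        fun z _ => ((hasDerivAt_id z).const_mul k).hasDerivWithinAt.congr_deriv (by simp)
      have ha := sub_le_sub_of_hasDerivWithinAt_le hX'.nonneg hX'.deriv hl fun _ _ => le_rfl
      have hb := sub_le_sub_of_hasDerivWithinAt_le hX'.nonneg hl hX'.deriv fun _ _ => le_rfl
      simp only [hX'.init, mul_zero] at ha hb
      linarith
    rw [hlin r hX.right_mem]
    refine h r hX.nonneg fun z hz => ?_
    rw [← hlin z hz]
    exact hX.domain z hz

theorem valid_der_comp (x y : L.Var) (hxy : x ≠ y) (f g : L.Fn 1) :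
    (Formula.box (.assign (.base y) (fn1 g (tv x))) (.box (.assign (.prime y) (.num 1))
      (Cmp.rel .eq (.der (fn1 f (fn1 g (tv x))))
        (.mul (.der (fn1 f (tv y))) (.der (fn1 g (tv x))))))).Valid := by
  intro I ν
  have hne : VarSym.base x ≠ VarSym.base y := by simpa using hxy
  have hne' : VarSym.prime x ≠ VarSym.prime y := by simpa using hxy
  have hmul : ∀ (θ η : Term L) (μ : State L),
      (Term.mul θ η).eval I μ = θ.eval I μ * η.eval I μ := fun _ _ _ => rfl
  rw [sat_box_assign, sat_box_assign, sat_rel_eq, hmul,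
    eval_der_of_single I (x := x) (g := fun X => I.fn1 f (I.fn1 g X))
      (fun μ => by simp only [eval_fn1, eval_tv]),
    eval_der_of_single I (x := y) (g := I.fn1 f)
      (fun μ => by simp only [eval_fn1, eval_tv]),
    eval_der_of_single I (x := x) (g := I.fn1 g)
      (fun μ => by simp only [eval_fn1, eval_tv])]
  simp only [State.upd_same, State.upd_of_ne _ _ hne', State.upd_base_prime,
    State.upd_of_ne _ _ (show VarSym.base x ≠ VarSym.prime y by simp),
    State.upd_of_ne _ _ (show VarSym.base y ≠ VarSym.prime y by simp), State.upd_of_ne _ _ hne,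
    eval_fn1, eval_tv]
  have hc : deriv (fun X => I.fn1 f (I.fn1 g X)) (ν (.base x)) =
      deriv (I.fn1 f) (I.fn1 g (ν (.base x))) *
        deriv (I.fn1 g) (ν (.base x)) :=
    ((I.differentiable_fn1 f _).hasDerivAt.comp (ν (.base x))
      (I.differentiable_fn1 g _).hasDerivAt).deriv
  rw [hc]
  simp [Term.eval]
  ring

theorem DLAx.valid {φ : Formula L} (h : DLAx φ) : φ.Valid := by
  cases h with
  | diamond xs a p =>
      intro I ν
      simp only [Formula.sat_iff, Formula.sat]
      push Not
      rfl
  | assignb x f p =>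
      intro I ν
      simp only [Formula.sat_iff, sat_box_assign, sat_pr1, eval_tv, State.upd_same, eval_fn0]
  | testb q p =>
      intro I ν
      simp only [Formula.sat_iff, Formula.sat_imp, Formula.sat, Prog.run, sat_pr0]
      exact ⟨fun h hq => h ν ⟨rfl, hq⟩, fun h _ hq => h hq.2⟩
  | choiceb xs a b p =>
      intro I ν
      simp only [Formula.sat_iff, Formula.sat, Prog.run, or_imp, forall_and]
  | composeb xs a b p =>
      intro I ν
      simp only [Formula.sat_iff, Formula.sat, Prog.run]
      exact ⟨fun h μ hμ ω hω => h ω ⟨μ, hμ, hω⟩, fun h ω ⟨μ, hμ, hω⟩ => h μ hμ ω hω⟩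
  | iterateb xs a p =>
      intro I ν
      simp only [Formula.sat_iff, Formula.sat, Prog.run]
      refine ⟨fun h => ⟨h ν .refl, fun μ hμ ω hω => h ω (.head hμ hω)⟩, fun h ω hω => ?_⟩
      rcases hω.cases_head with rfl | ⟨μ, hμ, hω⟩
      · exact h.1
      · exact h.2 μ hμ ω hω
  | K xs a p q =>
      intro I ν
      simp only [Formula.sat_imp, Formula.sat]
      exact fun h hp ω hω => h ω hω (hp ω hω)
  | I xs a p =>
      intro I ν
      simp only [Formula.sat_imp, Formula.sat, Prog.run]
      intro h hp ω hω
      induction hω with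
      | refl => exact hp
      | tail h1 h2 ih => exact h _ h1 ih _ h2
  | V a p =>
      intro I ν
      simp only [Formula.sat_imp, Formula.sat, sat_pr0]
      exact fun h _ _ => h
  | DW x f q => exact valid_differential_weakening x f q
  | DC x f p q r => exact valid_differential_cut x f p q r
  | DE x f q p => exact valid_differential_effect x f q _
  | DI x f q c g h => exact valid_differential_invariant x f q c g h
  | DG x y hxy f a b p q => exact valid_differential_ghost x y hxy f a b p q
  | DS x t s hxt hxs hts f p q => exact valid_differential_solution x t s hxt hxs hts f p q
  | Dassignb x f p =>
      intro I ν
      simp only [Formula.sat_iff, sat_box_assign, sat_pr1, eval_td, State.upd_same, eval_fn0]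
  | Dplus xs f g =>
      intro I ν
      rw [sat_rel_eq, eval_der_add]
      rfl
  | Dtimes xs f g =>
      intro I ν
      rw [sat_rel_eq, eval_der_mul]
      rfl
  | Dcompose x y hxy f g => exact valid_der_comp x y hxy f g

theorem DLRule.locallySound {R : Rule L} (h : DLRule R) : R.LocallySound := by
  cases h with
  | G xs a p =>
      intro I h ν
      simp only [List.forall_mem_singleton] at h
      rw [Formula.sat]
      exact fun ω _ => h ω
  | gen x p =>
      intro I h ν
      simp only [List.forall_mem_singleton] at h
      rw [Formula.sat]
      exact fun r => h _
  | MP p q =>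
      intro I h ν
      simp only [List.forall_mem_cons] at h
      exact (Formula.sat_imp I _ _ ν).1 (h.1 ν) (h.2.1 ν)
  | CT xs f g c =>
      intro I h ν
      simp only [List.forall_mem_singleton] at h
      rw [sat_rel_eq, eval_fn1, eval_fn1, (sat_rel_eq I _ _ ν).1 (h ν)]
  | CQ xs f g p =>
      intro I h ν
      simp only [List.forall_mem_singleton] at h
      rw [Formula.sat_iff, sat_pr1, sat_pr1, (sat_rel_eq I _ _ ν).1 (h ν)]
  | CE xs p q C =>
      intro I h ν
      simp only [List.forall_mem_singleton] at h
      have hpq : ∀ ω, (prv p xs).sat I ω ↔ (prv q xs).sat I ω :=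
        fun ω => (Formula.sat_iff I _ _ ω).1 (h ω)
      rw [Formula.sat_iff]
      simp only [Formula.sat, hpq]

end DL

theorem mainTheorem2 (L : DL.Lang) :
    -- every axiom is valid
    (∀ φ : DL.Formula L, DL.DLAx φ → φ.Valid) ∧
    -- every axiomatic proof rule is locally sound and sound
    (∀ R : DL.Rule L, DL.DLRule R → R.LocallySound ∧ R.Sound) ∧
    -- the uniform substitution rule is sound
    (∀ (σ : DL.USubst L) (φ : DL.Formula L), φ.Adm σ → φ.Valid → (φ.subst σ).Valid) ∧
    -- every uniform substitution instance of an axiomatic proof rule is sound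
    (∀ (R : DL.Rule L) (σ : DL.USubst L), DL.DLRule R → σ.fv = ∅ → R.Adm σ →
      (R.subst σ).Sound) ∧
    -- every uniform substitution instance of a locally sound rule is locally sound and sound
    (∀ (R : DL.Rule L) (σ : DL.USubst L), R.LocallySound → σ.fv = ∅ → R.Adm σ →
      (R.subst σ).LocallySound ∧ (R.subst σ).Sound) :=
  ⟨fun _ h => h.valid, fun _ h => ⟨h.locallySound, h.locallySound.sound⟩,
    fun _ _ hσ h => h.subst hσ, fun _ _ h hσ hR => (h.locallySound.subst hσ hR).sound,
    fun _ _ h hσ hR => ⟨h.subst hσ hR, (h.subst hσ hR).sound⟩⟩
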